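/- Let $X=(x_1,\dots,x_n)$ be a dataset of $n$ points in $\mathbb R^d$, $d\ge 1$, given in sparse form (each point is the list of its nonzero coordinates), let $\mathsf{nnz}(X)$ be the total number of nonzero coordinates, and assume $d\le \mathsf{nnz}(X)$ (which can be ensured by deleting coordinates that vanish on all of $X$). Let $k$ be an integer with $1\le k\le n$ and $z\ge 1$ a real number. The algorithm PRONE works as follows. 1. Draw $v\in\mathbb R^d$ with independent standard Gaussian coordinates and compute $x_i'=\langle x_i,v\rangle$ for all $i$. 2. Run $k$-means++ seeding on $x_1',\dots,x_n'$: the first center $\ell_1$ is uniform on $\{1,\dots,n\}$, and for $t=2,\dots,k$ the index $\ell_t$ is drawn with probability proportional to $p_i^z$, where $p_i=\min_{s<t}|x'_i-x'_{\ell_s}|$ (uniformly if all $p_i$ vanish). It is implemented thus: sort the points; keep the numbers $a_i=p_i^z$ in an array and in a complete binary tree whose nodes store partial sums; sample $\ell_t$ by drawing $r$ uniformly in $[0,\sum_i a_i)$ and descending in the tree; set $a_{\ell_t}=0$, scan from $\ell_t$ to the left and to the right in sorted order, replacing $a_i$ by $|x_i'-x_{\ell_t}'|^z$, until a point is reached for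 which this is not smaller than $a_i$; update the tree on the scanned interval. Finally sort the centers and assign each point to its closest center in one merging pass. 3. Replace each center by the center of mass (in $\mathbb R^d$, in sparse form) of the points assigned to it; an empty cluster keeps its center. Output the $k$ centers and the assignment. Count running time as the number of unit-cost operations on a real RAM (arithmetic including absolute values and real powers, comparisons, memory accesses, random draws, control steps). Then there is an absolute constant $C>0$ such that for all $d,n,k,z,X$ as above: (a) the expected running time of PRONE on $X$ is at most $C\left(\mathsf{nnz}(X)+2^{z/2}\,n\log n\right)$; (b) for every $\delta\in(0,1/2)$, with probability at least $1-\delta$ the running time is at most $C\left(\mathsf{nnz}(X)+2^{z/2}\,n\log (n/\delta)\right)$; (c) the running time is always at most $C\left(\mathsf{nnz}(X)+n\log n+nk\right)$. -/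

import Mathlib

open MeasureTheory ProbabilityTheory
open scoped ENNReal

/-! Running times are counted on a unit-cost real RAM: an arithmetic operation (`+`, `-`, `*`, `/`,
absolute value, real power, halving) on reals or indices, a comparison, an access to one array
cell, list cell or tree node, a random draw, and a step of control flow cost one unit each.

Arrays are functions on their index set. Every array is used linearly (after a write the old
version is never read again), so a write is an in-place write of unit cost.  A `fuel` argument only
makes a loop structurally recursive; it is at least the number of iterations that the loop makes. -/

noncomputable section

namespace Prone

/-- The result of a computation together with the number of unit-cost operations it performed. -/
structure Timed (α : Type) where
  val : α
  time : ℕ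

instance : Monad Timed where
  pure a := ⟨a, 0⟩
  bind p f := ⟨(f p.val).val, p.time + (f p.val).time⟩

/-- One unit-cost operation with result `a`. -/
def op {α : Type} (a : α) : Timed α := ⟨a, 1⟩

/-- One step of control flow (a procedure call or a loop test). -/
def tick : Timed Unit := ⟨(), 1⟩

/-- Read one array cell. -/
def rd {ι α : Type} (A : ι → α) (i : ι) : Timed α := ⟨A i, 1⟩

/-- Write one array cell. -/
def wr {ι α : Type} [DecidableEq ι] (A : ι → α) (i : ι) (x : α) : Timed (ι → α) :=
  ⟨Function.update A i x, 1⟩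

/-- Allocate an array with `m` cells, all filled with `x`. -/
def alloc {ι α : Type} (m : ℕ) (x : α) : Timed (ι → α) := ⟨fun _ => x, m + 1⟩

/-! ### Sorting -/

/-- Split a list into two lists whose lengths differ by at most one. -/
def split : List ℕ → Timed (List ℕ × List ℕ)
  | [] => op ([], [])
  | [a] => op ([a], [])
  | a :: b :: l => do
      tick
      let (p, q) ← split l
      let p ← op (a :: p)
      let q ← op (b :: q)
      return (p, q)

/-- Merge two sorted lists. -/
def merge (le : ℕ → ℕ → Timed Bool) : List ℕ → List ℕ → Timed (List ℕ)
  | [], q => op q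
  | a :: p, [] => op (a :: p)
  | a :: p, b :: q => do
      tick
      let c ← le a b
      if c then do
        let l ← merge le p (b :: q)
        op (a :: l)
      else do
        let l ← merge le (a :: p) q
        op (b :: l)
  termination_by p q => p.length + q.length

/-- Merge sort, with a comparison procedure `le`. -/
def mergeSort (le : ℕ → ℕ → Timed Bool) : (fuel : ℕ) → List ℕ → Timed (List ℕ)
  | 0, l => op l
  | _ + 1, [] => op []
  | _ + 1, [a] => op [a]
  | f + 1, a :: b :: l => do
      tick
      let (p, q) ← split (a :: b :: l)
      let p ← mergeSort le f p
      let q ← mergeSort le f q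
      merge le p q

/-- The list `[0, …, m - 1]`, prepended to `l`. -/
def indexList : ℕ → List ℕ → Timed (List ℕ)
  | 0, l => op l
  | m + 1, l => do
      tick
      let l ← op (m :: l)
      indexList m l

/-- Copy a list into the array `A`, from position `i` on. -/
def fill : List ℕ → ℕ → (ℕ → ℕ) → Timed (ℕ → ℕ)
  | [], _, A => op A
  | a :: l, i, A => do
      tick
      let A ← wr A i a
      let i ← op (i + 1)
      fill l i A

/-- Compare the keys of `i` and `j`. -/
def keyLe (x : ℕ → ℝ) (i j : ℕ) : Timed Bool := do
  let a ← rd x i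
  let b ← rd x j
  op (decide (a ≤ b))

/-- Compare two indices. -/
def idxLe (i j : ℕ) : Timed Bool := op (decide (i ≤ j))

/-! ### The binary tree for sampling -/

/-- A binary tree in which each node stores the sum of the numbers at the leaves below it. -/
inductive SumTree where
  | leaf (s : ℝ) : SumTree
  | node (s : ℝ) (l r : SumTree) : SumTree

namespace SumTree

/-- The number stored at the root. -/
def sum : SumTree → ℝ
  | leaf s => s
  | node s _ _ => s

/-- The smallest `q` with `n ≤ 2 ^ q`, and `2 ^ q`, by repeated doubling (started at `q = 0`,
`p = 1`). -/
def depth (n : ℕ) : (fuel : ℕ) → (q p : ℕ) → Timed (ℕ × ℕ)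
  | 0, q, p => return (q, p)
  | f + 1, q, p => do
      let big ← op (decide (n ≤ p))
      if big then return (q, p)
      else do
        let q ← op (q + 1)
        let p ← op (2 * p)
        depth n f q p

/-- The complete tree with `q + 1` layers on the `h = 2 ^ q` positions `off, …, off + h - 1`; the
leaf at position `i` stores `a i` if `i < n`, and `0` otherwise (padding). -/
def build (n : ℕ) (a : ℕ → ℝ) : (q : ℕ) → (off h : ℕ) → Timed SumTree
  | 0, off, _ => do
      let inside ← op (decide (off < n))
      if inside then do
        let v ← rd a off
        op (leaf v)
      else op (leaf 0)
  | q + 1, off, h => do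
      tick
      let h ← op (h / 2)
      let l ← build n a q off h
      let mid ← op (off + h)
      let r ← build n a q mid h
      let sl ← op l.sum
      let sr ← op r.sum
      let s ← op (sl + sr)
      op (node s l r)

/-- The position `ℓ` at which the partial sums of the leaves first exceed `r`, for a tree on the
positions `off, …, off + h - 1`. -/
def find : SumTree → (r : ℝ) → (off h : ℕ) → Timed ℕ
  | leaf _, _, off, _ => op off
  | node _ lt rt, r, off, h => do
      tick
      let h ← op (h / 2)
      let sl ← op lt.sum
      let left ← op (decide (r < sl))
      if left then find lt r off h
      else do
        let r ← op (r - sl)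
        let off ← op (off + h)
        find rt r off h

/-- Set the leaf at position `i` to `a i` for all `lo ≤ i < hi`, and correct the sums above, for a
tree on the positions `off, …, off + h - 1`. -/
def update (a : ℕ → ℝ) : SumTree → (lo hi off h : ℕ) → Timed SumTree
  | leaf _, _, _, off, _ => do
      let v ← rd a off
      op (leaf v)
  | node _ lt rt, lo, hi, off, h => do
      tick
      let h ← op (h / 2)
      let mid ← op (off + h)
      let onlyLeft ← op (decide (hi ≤ mid))
      let onlyRight ← op (decide (mid ≤ lo))
      let (lt, rt) ←
        if onlyLeft then do
          let lt ← update a lt lo hi off h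
          pure (lt, rt)
        else if onlyRight then do
          let rt ← update a rt lo hi mid h
          pure (lt, rt)
        else do
          let lt ← update a lt lo mid off h
          let rt ← update a rt mid hi mid h
          pure (lt, rt)
      let sl ← op lt.sum
      let sr ← op rt.sum
      let s ← op (sl + sr)
      op (node s lt rt)

end SumTree

/-! ### Seeding in one dimension. The points `y 0 ≤ … ≤ y (n - 1)` are sorted. -/

/-- `|y i - y c| ^ z`. -/
def distPow (y : ℕ → ℝ) (z : ℝ) (i c : ℕ) : Timed ℝ := do
  let p ← rd y i
  let q ← rd y c
  let s ← op (p - q)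
  let s ← op |s|
  op (s ^ z)

/-- A uniformly random index in `{0, …, n - 1}`, from a uniformly random `u ∈ [0, 1)`. -/
def drawIndex (n : ℕ) (u : ℝ) : Timed ℕ := op ⌊u * n⌋₊

/-- Set `a i` to `|y i - y c| ^ z` for all `i < m`. -/
def initDist (y : ℕ → ℝ) (z : ℝ) (c : ℕ) : (m : ℕ) → (ℕ → ℝ) → Timed (ℕ → ℝ)
  | 0, a => op a
  | m + 1, a => do
      tick
      let p ← distPow y z m c
      let a ← wr a m p
      initDist y z c m a

/-- Update `a` at `m - 1, m - 2, …` as long as the new center `y c` is closer than the old ones.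
Returns the smallest index that was updated (`m` if there is none) and the new array. -/
def scanLeft (y : ℕ → ℝ) (z : ℝ) (c : ℕ) : (m : ℕ) → (ℕ → ℝ) → Timed (ℕ × (ℕ → ℝ))
  | 0, a => do
      tick
      return (0, a)
  | i + 1, a => do
      tick
      let p ← distPow y z i c
      let ai ← rd a i
      let closer ← op (decide (p < ai))
      if closer then do
        let a ← wr a i p
        scanLeft y z c i a
      else return (i + 1, a)

/-- Update `a` at `j, j + 1, …` as long as the new center `y c` is closer than the old ones.
Returns the first index that was not updated and the new array. -/
def scanRight (n : ℕ) (y : ℕ → ℝ) (z : ℝ) (c : ℕ) :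
    (fuel : ℕ) → (j : ℕ) → (ℕ → ℝ) → Timed (ℕ × (ℕ → ℝ))
  | 0, j, a => return (j, a)
  | f + 1, j, a => do
      let inside ← op (decide (j < n))
      if inside then do
        let p ← distPow y z j c
        let aj ← rd a j
        let closer ← op (decide (p < aj))
        if closer then do
          let a ← wr a j p
          let j ← op (j + 1)
          scanRight n y z c f j a
        else return (j, a)
      else return (j, a)

/-- Choose `m` further centers, with the random numbers `u 0, …, u (m - 1) ∈ [0, 1)`, given the
array `a` of the `z`-th powers of the distances to the closest center, the tree `S` (on `h`
positions) for `a`, and the list `ls` of the centers chosen so far. If all weights are zero (every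
point coincides with a center), the next center is a uniformly random index. -/
def seedLoop (n : ℕ) (y : ℕ → ℝ) (z : ℝ) (h : ℕ) :
    (m : ℕ) → (u : Fin m → ℝ) → (a : ℕ → ℝ) → (S : SumTree) → (ls : List ℕ) → Timed (List ℕ)
  | 0, _, _, _, ls => return ls
  | m + 1, u, a, S, ls => do
      tick
      let total ← op S.sum
      let pos ← op (decide (0 < total))
      let l ←
        if pos then do
          let r ← op (u 0 * total)
          S.find r 0 h
        else drawIndex n (u 0)
      let a ← wr a l 0
      let (lo, a) ← scanLeft y z l l a
      let j ← op (l + 1)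
      let (hi, a) ← scanRight n y z l n j a
      let S ← S.update a lo hi 0 h
      let ls ← op (l :: ls)
      seedLoop n y z h m (Fin.tail u) a S ls

/-- Whether the assignment should pass from center `j` to center `j + 1` for the point `y i`. The
centers are `y (c 0) ≤ … ≤ y (c (k - 1))`. -/
def advance (k : ℕ) (y : ℕ → ℝ) (c : ℕ → ℕ) (i j : ℕ) : Timed Bool := do
  let j' ← op (j + 1)
  let hasNext ← op (decide (j' < k))
  if hasNext then do
    let c₀ ← rd c j
    let c₁ ← rd c j'
    let p ← rd y i
    let p₀ ← rd y c₀
    let p₁ ← rd y c₁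
    let s₀ ← op (p - p₀)
    let s₀ ← op |s₀|
    let s₁ ← op (p - p₁)
    let s₁ ← op |s₁|
    op (decide (s₁ ≤ s₀))
  else return false

/-- Assign every point to its closest center. The array `ord` gives the original index of each
sorted point, and the assignment `σ` is written in terms of the original indices. -/
def assign (n k : ℕ) (y : ℕ → ℝ) (c ord : ℕ → ℕ) :
    (fuel : ℕ) → (i j : ℕ) → (σ : ℕ → ℕ) → Timed (ℕ → ℕ)
  | 0, _, _, σ => return σ
  | f + 1, i, j, σ => do
      let more ← op (decide (i < n))
      if more then do
        let adv ← advance k y c i j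
        if adv then do
          let j ← op (j + 1)
          assign n k y c ord f i j σ
        else do
          let o ← rd ord i
          let σ ← wr σ o j
          let i ← op (i + 1)
          assign n k y c ord f i j σ
      else return σ

/-- Set `y i` to `x (ord i)` for all `i < m`. -/
def gather (x : ℕ → ℝ) (ord : ℕ → ℕ) : (m : ℕ) → (ℕ → ℝ) → Timed (ℕ → ℝ)
  | 0, y => op y
  | m + 1, y => do
      tick
      let o ← rd ord m
      let v ← rd x o
      let y ← wr y m v
      gather x ord m y

/-- Set `b j` to `ord (c j)` for all `j < m`. -/
def relabel (c ord : ℕ → ℕ) : (m : ℕ) → (ℕ → ℕ) → Timed (ℕ → ℕ)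
  | 0, b => op b
  | m + 1, b => do
      tick
      let l ← rd c m
      let o ← rd ord l
      let b ← wr b m o
      relabel c ord m b

/-- Efficient `k`-means++ seeding (with `z`-th powers of distances) for the points
`x 0, …, x (n - 1)` on the line. The random numbers are `u₁` (for the first center) and `u` (for the
other `k - 1` centers). Returns the indices of the `k` centers and the assignment of the points. -/
def seeding (n k : ℕ) (z : ℝ) (x : ℕ → ℝ) (u₁ : ℝ) (u : Fin (k - 1) → ℝ) :
    Timed ((ℕ → ℕ) × (ℕ → ℕ)) := do
  let idx ← indexList n []
  let sorted ← mergeSort (keyLe x) n idx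
  let ord ← alloc n 0
  let ord ← fill sorted 0 ord
  let y ← alloc n 0
  let y ← gather x ord n y
  let l₁ ← drawIndex n u₁
  let a ← alloc n 0
  let a ← initDist y z l₁ n a
  let (q, h) ← SumTree.depth n n 0 1
  let S ← SumTree.build n a q 0 h
  let ls ← seedLoop n y z h (k - 1) u a S [l₁]
  let ls ← mergeSort idxLe k ls
  let c ← alloc k 0
  let c ← fill ls 0 c
  let σ ← alloc n 0
  let σ ← assign n k y c ord (n + k) 0 0 σ
  let b ← alloc k 0
  let b ← relabel c ord k b
  return (b, σ)

/-! ### The algorithm. Points of `ℝ ^ d` are lists of their nonzero coordinates. -/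

/-- A point of `ℝ ^ d` in sparse representation. -/
abbrev SparseVec (d : ℕ) : Type := List (Fin d × ℝ)

variable {d : ℕ}

/-- `d` random draws, each of which is stored in one cell of an array. -/
def drawVector (v : Fin d → ℝ) : Timed (Fin d → ℝ) := ⟨v, 2 * d + 1⟩

/-- The inner product with `v`, added to `s`. -/
def dot (v : Fin d → ℝ) : SparseVec d → (s : ℝ) → Timed ℝ
  | [], s => op s
  | (j, x) :: row, s => do
      tick
      let vj ← rd v j
      let p ← op (x * vj)
      let s ← op (s + p)
      dot v row s

/-- Project the points with indices below `m` to the line. -/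
def project (rows : ℕ → SparseVec d) (v : Fin d → ℝ) : (m : ℕ) → (ℕ → ℝ) → Timed (ℕ → ℝ)
  | 0, x => op x
  | m + 1, x => do
      tick
      let row ← rd rows m
      let s ← dot v row 0
      let x ← wr x m s
      project rows v m x

/-- Collect the points with indices below `m` into the clusters given by `σ`. -/
def bucket (σ : ℕ → ℕ) : (m : ℕ) → (ℕ → List ℕ) → Timed (ℕ → List ℕ)
  | 0, B => op B
  | m + 1, B => do
      tick
      let s ← rd σ m
      let l ← rd B s
      let l ← op (m :: l)
      let B ← wr B s l
      bucket σ m B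

/-- Add a sparse vector to the dense vector `acc`; the list `js` contains all the coordinates at
which `acc` is nonzero. -/
def addRow : SparseVec d → (acc : Fin d → ℝ) → (js : List (Fin d)) →
    Timed ((Fin d → ℝ) × List (Fin d))
  | [], acc, js => op (acc, js)
  | (j, x) :: row, acc, js => do
      tick
      let v ← rd acc j
      let new ← op (decide (v = 0))
      let js ← if new then op (j :: js) else pure js
      let w ← op (v + x)
      let acc ← wr acc j w
      addRow row acc js

/-- Add the points with the given indices to `acc`, and their number to `cnt`. -/
def addRows (rows : ℕ → SparseVec d) : List ℕ → (acc : Fin d → ℝ) → (js : List (Fin d)) →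
    (cnt : ℝ) → Timed ((Fin d → ℝ) × List (Fin d) × ℝ)
  | [], acc, js, cnt => op (acc, js, cnt)
  | i :: l, acc, js, cnt => do
      tick
      let row ← rd rows i
      let (acc, js) ← addRow row acc js
      let cnt ← op (cnt + 1)
      addRows rows l acc js cnt

/-- Divide `acc` by `cnt`, append the result to `out` in sparse form, and reset `acc` to zero. -/
def divide (cnt : ℝ) : List (Fin d) → (acc : Fin d → ℝ) → (out : SparseVec d) →
    Timed ((Fin d → ℝ) × SparseVec d)
  | [], acc, out => op (acc, out)
  | j :: js, acc, out => do
      tick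
      let v ← rd acc j
      let acc ← wr acc j 0
      let zero ← op (decide (v = 0))
      if zero then divide cnt js acc out
      else do
        let w ← op (v / cnt)
        let out ← op ((j, w) :: out)
        divide cnt js acc out

/-- Set `C ℓ` to the center of mass of cluster `ℓ`, for all `ℓ < m`. An empty cluster keeps the
data point with index `b ℓ` as its center (by reference). -/
def centroids (rows : ℕ → SparseVec d) (B : ℕ → List ℕ) (b : ℕ → ℕ) :
    (m : ℕ) → (acc : Fin d → ℝ) → (C : ℕ → SparseVec d) → Timed (ℕ → SparseVec d)
  | 0, _, C => op C
  | m + 1, acc, C => do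
      tick
      let l ← rd B m
      let empty ← op l.isEmpty
      if empty then do
        let o ← rd b m
        let row ← rd rows o
        let C ← wr C m row
        centroids rows B b m acc C
      else do
        let (acc, js, cnt) ← addRows rows l acc [] 0
        let (acc, out) ← divide cnt js acc []
        let C ← wr C m out
        centroids rows B b m acc C

/-- The algorithm on `n` points in `ℝ ^ d`: project the points onto the random vector `v`, run
`k`-means++ seeding on the projections, and replace each center by the center of mass of its
cluster. Returns the `k` centers and the assignment. -/
def prone (n k : ℕ) (z : ℝ) (rows : ℕ → SparseVec d)
    (v : Fin d → ℝ) (u₁ : ℝ) (u : Fin (k - 1) → ℝ) :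
    Timed ((ℕ → SparseVec d) × (ℕ → ℕ)) := do
  let v ← drawVector v
  let x ← alloc n 0
  let x ← project rows v n x
  let (b, σ) ← seeding n k z x u₁ u
  let B ← alloc k []
  let B ← bucket σ n B
  let acc ← alloc d 0
  let C ← alloc k []
  let C ← centroids rows B b k acc C
  return (C, σ)

/-! ### Input, randomness and running time -/

/-- The number of nonzero coordinates of a dataset. -/
def nnz {n : ℕ} (X : Fin n → EuclideanSpace ℝ (Fin d)) : ℕ :=
  (Finset.univ.filter fun p : Fin n × Fin d => X p.1 p.2 ≠ 0).card

/-- The list of the nonzero coordinates of a point. -/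
def sparse (p : EuclideanSpace ℝ (Fin d)) : SparseVec d :=
  ((List.finRange d).filter fun j => decide (p j ≠ 0)).map fun j => (j, p j)

/-- A dataset as an array of sparse vectors. -/
def sparseRows {n : ℕ} (X : Fin n → EuclideanSpace ℝ (Fin d)) (i : ℕ) : SparseVec d :=
  if h : i < n then sparse (X ⟨i, h⟩) else []

/-- The random numbers the algorithm uses: the coordinates of the projection vector, and one number
for each of the `k` centers. -/
abbrev Tape (d k : ℕ) : Type := (Fin d → ℝ) × ℝ × (Fin (k - 1) → ℝ)

/-- The uniform distribution on `[0, 1)`. -/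
def uniform01 : Measure ℝ := (volume : Measure ℝ).restrict (Set.Ico 0 1)

/-- The law of the random numbers: independent standard Gaussians for the projection vector, and
independent uniform numbers in `[0, 1)` for the centers. -/
def tapeLaw (d k : ℕ) : Measure (Tape d k) :=
  (Measure.pi fun _ : Fin d => gaussianReal 0 1).prod
    (uniform01.prod (Measure.pi fun _ : Fin (k - 1) => uniform01))

/-- The possible outcomes of the random draws. -/
def IsTape {d k : ℕ} (ω : Tape d k) : Prop :=
  ω.2.1 ∈ Set.Ico (0 : ℝ) 1 ∧ ∀ t, ω.2.2 t ∈ Set.Ico (0 : ℝ) 1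

/-- The running time of the algorithm on the dataset `X` when the random numbers are `ω`. -/
def runTime {n : ℕ} (X : Fin n → EuclideanSpace ℝ (Fin d)) (k : ℕ) (z : ℝ) (ω : Tape d k) : ℕ :=
  (prone n k z (sparseRows X) ω.1 ω.2.1 ω.2.2).time

end Prone

end

/-!
The running time splits into a part that hardly depends on the random numbers, which is
`O(nnz X + n log n)` by direct counting, and the scans of the seeding loop, whose total length is,
up to `k`, the number of pairs (point, round) such that the weight of the point decreases in that
round (`seedModel_time_le_hits`).

The counting of the scans rests on an exact description of the seeding loop. The array of weights
and the sampling tree are functions of the list of chosen centers: a point at which a scan stops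
shields all points behind it (`weight_le_of_between`), so a round replaces the array by the weights
for the enlarged list (`scanned_eq_weight`), and the tree by the correct tree for them
(`SumTree.update_ofFun_val`). Hence the loop agrees with `seedModel`, whose only state is this list
(`seedLoop_eq`).

The number of decreases of the weight of a fixed point `i` is controlled by a potential: the product
of the numbers (plus one) of points to the left and to the right of `i` that would decrease its
weight if they were chosen. If such a point `j` is chosen, then on its side only the points closer
to `i` than `j` remain. On one side, the distance of a point `j` to its closest center is at most
twice that of each point between `i` and `j` (`weight_le_two_rpow_mul`), so the weight of `j`
is at most `2 ^ z` times the weights of the points closer to `i` on its side. An elementary inequality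
(`card_mul_sum_le`) turns this into an expected relative decrease of the number of points by at
least `2 ^ (-z / 2) / 8`; the square root comes from balancing few heavy distant points against
many light close ones. Therefore `exp (2 ^ (-z / 2) / 8 * (number of decreases))` has expectation at
most the initial potential, which is at most `(n + 1) ^ 2` (`lintegral_exp_hits_le`). This holds for
every projection vector and every first center; only the draws of the further centers matter.

By convexity of `exp` the same bound holds for the average over all points, that is, for the
exponential moment of the normalized running time (`lintegral_exp_runTimeModel_le`). The bound for
the expectation follows from `x ≤ log M + exp x / M`, the tail bound from Markov's inequality.
The deterministic bound holds because each scan has length at most `n`.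

The running time is measurable because the algorithm uses its real numbers only in finitely many
comparisons and roundings: everything that influences the running time is a function with countably
many values, taken on measurable sets (`DiscreteMeasurable`).
-/

namespace Prone

/-! ### Values and costs of the basic operations -/

section Basic

variable {α β ι : Type}

@[simp] lemma bind_val (p : Timed α) (f : α → Timed β) : (p >>= f).val = (f p.val).val := rfl
@[simp] lemma bind_time (p : Timed α) (f : α → Timed β) :
    (p >>= f).time = p.time + (f p.val).time := rfl
@[simp] lemma pure_val (a : α) : (pure a : Timed α).val = a := rfl
@[simp] lemma pure_time (a : α) : (pure a : Timed α).time = 0 := rfl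
@[simp] lemma op_val (a : α) : (op a).val = a := rfl
@[simp] lemma op_time (a : α) : (op a).time = 1 := rfl
@[simp] lemma tick_time : tick.time = 1 := rfl
@[simp] lemma rd_val (A : ι → α) (i : ι) : (rd A i).val = A i := rfl
@[simp] lemma rd_time (A : ι → α) (i : ι) : (rd A i).time = 1 := rfl
@[simp] lemma wr_val [DecidableEq ι] (A : ι → α) (i : ι) (x : α) :
    (wr A i x).val = Function.update A i x := rfl
@[simp] lemma wr_time [DecidableEq ι] (A : ι → α) (i : ι) (x : α) : (wr A i x).time = 1 := rfl
@[simp] lemma alloc_val (m : ℕ) (x : α) : (alloc m x : Timed (ι → α)).val = fun _ => x := rfl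
@[simp] lemma alloc_time (m : ℕ) (x : α) : (alloc m x : Timed (ι → α)).time = m + 1 := rfl

lemma Timed.ext {p q : Timed α} (h : p.val = q.val) (h' : p.time = q.time) : p = q := by
  cases p; cases q; simp_all

end Basic

/-! ### Merge sort -/

lemma split_spec (l : List ℕ) :
    (split l).time ≤ 2 * l.length + 1 ∧
    2 * (split l).val.1.length ≤ l.length + 1 ∧ 2 * (split l).val.2.length ≤ l.length ∧
    (split l).val.1.length + (split l).val.2.length = l.length := by
  induction l using split.induct with
  | case1 => simp [split]
  | case2 a => simp [split]
  | case3 a b l ih => simp [split]; omega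

lemma merge_time {le : ℕ → ℕ → Timed Bool} (hle : ∀ a b, (le a b).time ≤ 3) (p q : List ℕ) :
    (merge le p q).time ≤ 5 * (p.length + q.length) + 1 := by
  induction p, q using merge.induct with
  | case1 q => simp [merge]
  | case2 a p => simp [merge]
  | case3 a p b q ih1 ih2 =>
    have := hle a b
    rw [merge]
    simp only [bind_time]
    split_ifs
    · simp at *; omega
    · simp at *; omega

lemma merge_length (le : ℕ → ℕ → Timed Bool) (p q : List ℕ) :
    (merge le p q).val.length = p.length + q.length := by
  induction p, q using merge.induct with
  | case1 q => simp [merge]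
  | case2 a p => simp [merge]
  | case3 a p b q ih1 ih2 =>
    rw [merge]
    simp only [bind_val]
    split_ifs
    · simp at *; omega
    · simp at *; omega

lemma mem_of_mem_merge {le : ℕ → ℕ → Timed Bool} {p q : List ℕ} {x : ℕ}
    (hx : x ∈ (merge le p q).val) : x ∈ p ∨ x ∈ q := by
  induction p, q using merge.induct with
  | case1 q => simpa [merge] using hx
  | case2 a p => simpa [merge] using hx
  | case3 a p b q ih1 ih2 =>
    rw [merge] at hx
    simp only [bind_val] at hx
    split_ifs at hx
    · simp at *; tauto
    · simp at *; tauto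

lemma merge_sorted {x : ℕ → ℝ} {p q : List ℕ} (hp : p.Pairwise (fun a b => x a ≤ x b))
    (hq : q.Pairwise (fun a b => x a ≤ x b)) :
    (merge (keyLe x) p q).val.Pairwise (fun a b => x a ≤ x b) := by
  induction p, q using merge.induct with
  | case1 q => simpa [merge] using hq
  | case2 a p => simpa [merge] using hp
  | case3 a p b q ih1 ih2 =>
    rw [merge]
    simp only [bind_val]
    rw [List.pairwise_cons] at hp hq
    split_ifs with h
    · replace h : x a ≤ x b := of_decide_eq_true h
      simp only [bind_val, op_val, List.pairwise_cons]
      refine ⟨fun c hc => ?_, ih1 hp.2 (List.pairwise_cons.2 hq)⟩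
      rcases mem_of_mem_merge hc with hc | hc
      · exact hp.1 c hc
      · rcases List.mem_cons.1 hc with rfl | hc
        · exact h
        · exact h.trans (hq.1 c hc)
    · replace h : x b < x a := not_le.1 (of_decide_eq_false (Bool.eq_false_of_not_eq_true h))
      simp only [bind_val, op_val, List.pairwise_cons]
      refine ⟨fun c hc => ?_, ih2 (List.pairwise_cons.2 hp) hq.2⟩
      rcases mem_of_mem_merge hc with hc | hc
      · rcases List.mem_cons.1 hc with rfl | hc
        · exact h.le
        · exact h.le.trans (hp.1 c hc)
      · exact hq.1 c hc

lemma mergeSort_length (le : ℕ → ℕ → Timed Bool) (f : ℕ) (l : List ℕ) :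
    (mergeSort le f l).val.length = l.length := by
  induction f generalizing l with
  | zero => simp [mergeSort]
  | succ f ih =>
    match l with
    | [] => simp [mergeSort]
    | [a] => simp [mergeSort]
    | a :: b :: l =>
      simp only [mergeSort, bind_val, merge_length, ih]
      exact (split_spec (a :: b :: l)).2.2.2

lemma mergeSort_time {le : ℕ → ℕ → Timed Bool} (hle : ∀ a b, (le a b).time ≤ 3) (f : ℕ)
    (l : List ℕ) (Q : ℕ) (hQ : l.length ≤ 2 ^ Q) :
    (mergeSort le f l).time ≤ 10 * l.length * Q + 1 := by
  induction f generalizing l Q with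
  | zero => simp [mergeSort]
  | succ f ih =>
    match l with
    | [] => simp [mergeSort]
    | [a] => simp [mergeSort]
    | a :: b :: l =>
      simp only [mergeSort, bind_time]
      obtain ⟨h1, h2, h3, h4⟩ := split_spec (a :: b :: l)
      generalize split (a :: b :: l) = s at *
      obtain ⟨⟨p, q⟩, t⟩ := s
      simp only [List.length_cons] at *
      cases Q with
      | zero => simp at hQ
      | succ Q =>
        rw [pow_succ] at hQ
        have e1 := ih p Q (by omega)
        have e2 := ih q Q (by omega)
        have e3 := merge_time hle (mergeSort le f p).val (mergeSort le f q).val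
        simp only [mergeSort_length] at e3
        have e4 : 10 * (l.length + 1 + 1) * (Q + 1)
            = 10 * p.length * Q + 10 * q.length * Q + 10 * (l.length + 1 + 1) := by
          rw [← h4]; ring
        rw [e4]
        simp only [tick_time]
        omega

lemma mergeSort_sorted {x : ℕ → ℝ} (f : ℕ) (l : List ℕ) (hf : l.length ≤ f) :
    (mergeSort (keyLe x) f l).val.Pairwise (fun a b => x a ≤ x b) := by
  induction f generalizing l with
  | zero =>
    have : l = [] := by simpa using hf
    subst this; simp [mergeSort]
  | succ f ih =>
    match l with
    | [] => simp [mergeSort]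
    | [a] => simp [mergeSort]
    | a :: b :: l =>
      simp only [mergeSort, bind_val]
      obtain ⟨h1, h2, h3, h4⟩ := split_spec (a :: b :: l)
      generalize split (a :: b :: l) = s at *
      obtain ⟨⟨p, q⟩, t⟩ := s
      simp at *
      exact merge_sorted (ih p (by omega)) (ih q (by omega))

lemma keyLe_time (x : ℕ → ℝ) (i j : ℕ) : (keyLe x i j).time ≤ 3 := by simp [keyLe]

lemma idxLe_time (i j : ℕ) : (idxLe i j).time ≤ 3 := by simp [idxLe]

/-! ### Loops whose cost does not depend on the data -/

lemma indexList_spec (m : ℕ) (l : List ℕ) :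
    (indexList m l).time = 2 * m + 1 ∧ (indexList m l).val.length = m + l.length := by
  induction m generalizing l with
  | zero => simp [indexList]
  | succ m ih => simp [indexList, ih]; omega

lemma fill_time (l : List ℕ) (i : ℕ) (A : ℕ → ℕ) : (fill l i A).time = 3 * l.length + 1 := by
  induction l generalizing i A with
  | nil => simp [fill]
  | cons a l ih => simp [fill, ih]; omega

lemma fill_val (l : List ℕ) (i : ℕ) (A : ℕ → ℕ) (j : ℕ) :
    (fill l i A).val j = if h : i ≤ j ∧ j - i < l.length then l[j - i]'h.2 else A j := by
  induction l generalizing i A with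
  | nil => simp [fill]
  | cons a l ih =>
    simp only [fill, bind_val, wr_val, op_val, ih]
    rcases lt_trichotomy j i with h | h | h
    · rw [dif_neg (by omega), dif_neg (by omega), Function.update_of_ne (by omega)]
    · subst h; simp
    · obtain ⟨e, rfl⟩ : ∃ e, j = i + 1 + e := ⟨j - (i + 1), by omega⟩
      have e1 : i + 1 + e - (i + 1) = e := by omega
      have e2 : i + 1 + e - i = e + 1 := by omega
      simp only [e1, e2, List.length_cons]
      rw [Function.update_of_ne (by omega)]
      by_cases he : e < l.length
      · rw [dif_pos ⟨by omega, he⟩, dif_pos ⟨by omega, by omega⟩]; simp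
      · rw [dif_neg (by omega), dif_neg (by omega)]

lemma gather_spec (x : ℕ → ℝ) (ord : ℕ → ℕ) (m : ℕ) (y : ℕ → ℝ) :
    (gather x ord m y).time = 4 * m + 1 ∧
    (gather x ord m y).val = fun i => if i < m then x (ord i) else y i := by
  induction m generalizing y with
  | zero => simp [gather]
  | succ m ih =>
    simp only [gather, bind_val, bind_time, ih]
    refine ⟨by simp; omega, funext fun i => ?_⟩
    simp only [rd_val, wr_val, Function.update_apply]
    rcases lt_trichotomy i m with h | h | h
    · simp [h, Nat.lt_succ_of_lt h]
    · simp [h]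
    · rw [if_neg (by omega), if_neg (by omega), if_neg (by omega)]

lemma relabel_time (c ord : ℕ → ℕ) (m : ℕ) (b : ℕ → ℕ) :
    (relabel c ord m b).time = 4 * m + 1 := by
  induction m generalizing b with
  | zero => simp [relabel]
  | succ m ih => simp [relabel, ih]; omega

lemma advance_time (k : ℕ) (y : ℕ → ℝ) (c : ℕ → ℕ) (i j : ℕ) :
    (advance k y c i j).time ≤ 12 := by
  by_cases h : j + 1 < k <;> simp [advance, h]

lemma assign_time (n k : ℕ) (y : ℕ → ℝ) (c ord : ℕ → ℕ) (f i j : ℕ) (σ : ℕ → ℕ) :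
    (assign n k y c ord f i j σ).time ≤ 16 * f := by
  induction f generalizing i j σ with
  | zero => simp [assign]
  | succ f ih =>
    have h := advance_time k y c i j
    by_cases hi : i < n
    · by_cases ha : (advance k y c i j).val = true
      · have := ih i (j + 1) σ
        simp [assign, hi, ha]; omega
      · have := ih (i + 1) j (Function.update σ (ord i) j)
        simp [assign, hi, ha]; omega
    · simp [assign, hi]; omega

@[simp] lemma distPow_val (y : ℕ → ℝ) (z : ℝ) (i c : ℕ) :
    (distPow y z i c).val = |y i - y c| ^ z := rfl

@[simp] lemma distPow_time (y : ℕ → ℝ) (z : ℝ) (i c : ℕ) : (distPow y z i c).time = 5 := rfl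

lemma initDist_spec (y : ℕ → ℝ) (z : ℝ) (c m : ℕ) (a : ℕ → ℝ) :
    (initDist y z c m a).time = 7 * m + 1 ∧
    (initDist y z c m a).val = fun i => if i < m then |y i - y c| ^ z else a i := by
  induction m generalizing a with
  | zero => simp [initDist]
  | succ m ih =>
    simp only [initDist, bind_val, bind_time, ih]
    refine ⟨by simp; omega, funext fun i => ?_⟩
    simp only [distPow_val, wr_val, Function.update_apply]
    rcases lt_trichotomy i m with h | h | h
    · simp [h, Nat.lt_succ_of_lt h]
    · simp [h]
    · rw [if_neg (by omega), if_neg (by omega), if_neg (by omega)]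

/-! ### Projection and centers of mass -/

section Vectors

variable {d : ℕ}

lemma dot_time (v : Fin d → ℝ) (row : SparseVec d) (s : ℝ) :
    (dot v row s).time = 4 * row.length + 1 := by
  induction row generalizing s with
  | nil => simp [dot]
  | cons p row ih => obtain ⟨j, x⟩ := p; simp [dot, ih]; omega

lemma project_time (rows : ℕ → SparseVec d) (v : Fin d → ℝ) (m : ℕ) (x : ℕ → ℝ) :
    (project rows v m x).time = 4 * m + 1 + 4 * ∑ i ∈ Finset.range m, (rows i).length := by
  induction m generalizing x with
  | zero => simp [project]
  | succ m ih => simp [project, ih, dot_time, Finset.sum_range_succ]; omega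

lemma bucket_time (σ : ℕ → ℕ) (m : ℕ) (B : ℕ → List ℕ) : (bucket σ m B).time = 5 * m + 1 := by
  induction m generalizing B with
  | zero => simp [bucket]
  | succ m ih => simp [bucket, ih]; omega

/-- Each index below `m` is put into one bucket only. -/
lemma bucket_sum (σ : ℕ → ℕ) (g : ℕ → ℕ) (k m : ℕ) (B : ℕ → List ℕ) :
    ∑ s ∈ Finset.range k, (((bucket σ m B).val s).map g).sum
      ≤ ∑ s ∈ Finset.range k, ((B s).map g).sum + ∑ i ∈ Finset.range m, g i := by
  induction m generalizing B with
  | zero => simp [bucket]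
  | succ m ih =>
    simp only [bucket, bind_val]
    refine (ih _).trans ?_
    simp only [rd_val, op_val, wr_val]
    rw [Finset.sum_range_succ, add_comm _ (g m), ← add_assoc]
    gcongr ?_ + _
    have : ∀ s ∈ Finset.range k, ((Function.update B (σ m) (m :: B (σ m)) s).map g).sum
        = ((B s).map g).sum + if s = σ m then g m else 0 := by
      intro s _
      by_cases h : s = σ m
      · subst h; simp [add_comm]
      · simp [h]
    rw [Finset.sum_congr rfl this, Finset.sum_add_distrib, Finset.sum_ite_eq']
    gcongr
    split_ifs <;> simp

lemma addRow_spec (row : SparseVec d) (acc : Fin d → ℝ) (js : List (Fin d)) :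
    (addRow row acc js).time ≤ 6 * row.length + 1 ∧
    (addRow row acc js).val.2.length ≤ js.length + row.length := by
  induction row generalizing acc js with
  | nil => simp [addRow]
  | cons p row ih =>
    obtain ⟨j, x⟩ := p
    by_cases h : acc j = 0
    · have := ih (Function.update acc j (acc j + x)) (j :: js)
      simp [addRow, h] at *; omega
    · have := ih (Function.update acc j (acc j + x)) js
      simp [addRow, h] at *; omega

lemma addRows_spec (rows : ℕ → SparseVec d) (l : List ℕ) (acc : Fin d → ℝ) (js : List (Fin d))
    (cnt : ℝ) :
    (addRows rows l acc js cnt).time ≤ (l.map fun i => 6 * (rows i).length + 4).sum + 1 ∧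
    (addRows rows l acc js cnt).val.2.1.length
      ≤ js.length + (l.map fun i => (rows i).length).sum := by
  induction l generalizing acc js cnt with
  | nil => simp [addRows]
  | cons i l ih =>
    have h := addRow_spec (rows i) acc js
    have := ih (addRow (rows i) acc js).val.1 (addRow (rows i) acc js).val.2 (cnt + 1)
    simp only [addRows, bind_time, bind_val, rd_val, rd_time, op_val, op_time, tick_time,
      List.map_cons, List.sum_cons]
    omega

lemma divide_time (cnt : ℝ) (js : List (Fin d)) (acc : Fin d → ℝ) (out : SparseVec d) :
    (divide cnt js acc out).time ≤ 6 * js.length + 1 := by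
  induction js generalizing acc out with
  | nil => simp [divide]
  | cons j js ih =>
    by_cases h : acc j = 0
    · have := ih (Function.update acc j 0) out
      simp [divide, h]; omega
    · have := ih (Function.update acc j 0) ((j, acc j / cnt) :: out)
      simp [divide, h]; omega

lemma centroids_time (rows : ℕ → SparseVec d) (B : ℕ → List ℕ) (b : ℕ → ℕ) (m : ℕ)
    (acc : Fin d → ℝ) (C : ℕ → SparseVec d) :
    (centroids rows B b m acc C).time
      ≤ 6 * m + 1 + ∑ s ∈ Finset.range m, ((B s).map fun i => 12 * (rows i).length + 4).sum := by
  induction m generalizing acc C with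
  | zero => simp [centroids]
  | succ m ih =>
    rw [Finset.sum_range_succ]
    by_cases hB : (B m).isEmpty = true
    · have := ih acc (Function.update C m (rows (b m)))
      simp only [centroids, bind_time, rd_val, op_val, rd_time, op_time, tick_time, hB, if_true,
        wr_val, wr_time]
      omega
    · simp only [centroids, bind_time, rd_val, op_val, rd_time, op_time, tick_time, hB, if_false,
        wr_val, wr_time, Bool.false_eq_true]
      obtain ⟨h1, h2⟩ := addRows_spec rows (B m) acc [] 0
      generalize addRows rows (B m) acc [] 0 = s at *
      obtain ⟨⟨acc', js, cnt⟩, t⟩ := s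
      have h3 := divide_time cnt js acc' []
      generalize divide cnt js acc' [] = r at *
      obtain ⟨⟨acc'', out⟩, t'⟩ := r
      have := ih acc'' (Function.update C m out)
      have e : ((B m).map fun i => 12 * (rows i).length + 4).sum
          = ((B m).map fun i => 6 * (rows i).length + 4).sum
            + 6 * ((B m).map fun i => (rows i).length).sum := by
        rw [← List.sum_map_mul_left, ← List.sum_map_add]
        congr 2; ext i; ring
      dsimp only at *
      simp only [List.length_nil, zero_add] at h2
      omega

lemma sum_sparseRows_length {n : ℕ} (X : Fin n → EuclideanSpace ℝ (Fin d)) :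
    ∑ i ∈ Finset.range n, (sparseRows X i).length = nnz X := by
  rw [Finset.sum_range, nnz, Finset.card_filter, Fintype.sum_prod_type]
  refine Finset.sum_congr rfl fun i _ => ?_
  rw [sparseRows, dif_pos i.2, sparse, List.length_map, ← Finset.card_filter]
  rw [← List.toFinset_card_of_nodup ((List.nodup_finRange d).filter _)]
  congr 1
  ext j
  simp

end Vectors

/-! ### The sampling tree -/

namespace SumTree

/-- The complete tree of depth `q` whose leaves store `a off, …, a (off + 2 ^ q - 1)` and whose
inner nodes store the correct partial sums. -/
noncomputable def ofFun (a : ℕ → ℝ) : (q off : ℕ) → SumTree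
  | 0, off => leaf (a off)
  | q + 1, off =>
    node ((ofFun a q off).sum + (ofFun a q (off + 2 ^ q)).sum) (ofFun a q off)
      (ofFun a q (off + 2 ^ q))

lemma sum_ofFun_succ (a : ℕ → ℝ) (q off : ℕ) :
    (ofFun a (q + 1) off).sum = (ofFun a q off).sum + (ofFun a q (off + 2 ^ q)).sum := rfl

lemma sum_ofFun (a : ℕ → ℝ) (q off : ℕ) :
    (ofFun a q off).sum = ∑ i ∈ Finset.Ico off (off + 2 ^ q), a i := by
  induction q generalizing off with
  | zero => simp [ofFun, sum]
  | succ q ih =>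
    rw [sum_ofFun_succ, ih, ih,
      Finset.sum_Ico_consecutive _ (Nat.le_add_right _ _) (Nat.le_add_right _ _)]
    congr 2; rw [pow_succ]; omega

lemma depth_spec (n f q : ℕ) (hn : n ≤ 2 ^ (q + f)) :
    (depth n f q (2 ^ q)).val.2 = 2 ^ (depth n f q (2 ^ q)).val.1 ∧
    n ≤ 2 ^ (depth n f q (2 ^ q)).val.1 ∧
    2 ^ (depth n f q (2 ^ q)).val.1 ≤ max (2 ^ q) (2 * n) ∧
    (depth n f q (2 ^ q)).time + 3 * q ≤ 3 * (depth n f q (2 ^ q)).val.1 + 1 := by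
  induction f generalizing q with
  | zero => simp [depth]; simpa using hn
  | succ f ih =>
    by_cases h : n ≤ 2 ^ q
    · simp [depth, h]; omega
    · have e : 2 * 2 ^ q = 2 ^ (q + 1) := by ring
      obtain ⟨h1, h2, h3, h4⟩ := ih (q + 1) (by rwa [Nat.add_right_comm])
      simp only [depth, bind_val, bind_time, op_val, op_time, h, decide_false, Bool.false_eq_true,
        if_false, e]
      refine ⟨h1, h2, h3.trans ?_, by omega⟩
      rw [max_eq_right (by omega)]
      exact le_max_of_le_right le_rfl

lemma build_spec (n : ℕ) (a : ℕ → ℝ) (ha : ∀ i, n ≤ i → a i = 0) (q off : ℕ) :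
    (build n a q off (2 ^ q)).val = ofFun a q off ∧
    (build n a q off (2 ^ q)).time + 7 ≤ 10 * 2 ^ q := by
  induction q generalizing off with
  | zero =>
    by_cases h : off < n
    · simp [build, h, ofFun]
    · simp [build, h, ofFun, ha off (by omega)]
  | succ q ih =>
    have e : 2 ^ (q + 1) / 2 = 2 ^ q := by rw [pow_succ]; omega
    simp only [build, bind_val, bind_time, op_val, op_time, e, ih, ofFun, tick_time, true_and]
    have h1 := (ih off).2
    have h2 := (ih (off + 2 ^ q)).2
    rw [pow_succ]
    omega

lemma find_ofFun_time (a : ℕ → ℝ) (q : ℕ) (r : ℝ) (off : ℕ) :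
    ((ofFun a q off).find r off (2 ^ q)).time ≤ 6 * q + 1 := by
  induction q generalizing off r with
  | zero => simp [ofFun, find]
  | succ q ih =>
    have e : 2 ^ (q + 1) / 2 = 2 ^ q := by rw [pow_succ]; omega
    by_cases h : r < (ofFun a q off).sum
    · have := ih r off
      simp [ofFun, find, e, h]; omega
    · have := ih (r - (ofFun a q off).sum) (off + 2 ^ q)
      simp [ofFun, find, e, h]; omega

/-- The search returns the position at which the partial sums first exceed `r`. -/
lemma find_ofFun_val (a : ℕ → ℝ) (q : ℕ) (r : ℝ) (off : ℕ) (h0 : 0 ≤ r)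
    (h1 : r < (ofFun a q off).sum) :
    off ≤ ((ofFun a q off).find r off (2 ^ q)).val ∧
    ((ofFun a q off).find r off (2 ^ q)).val < off + 2 ^ q ∧
    ∑ i ∈ Finset.Ico off ((ofFun a q off).find r off (2 ^ q)).val, a i ≤ r ∧
    r < ∑ i ∈ Finset.Ico off (((ofFun a q off).find r off (2 ^ q)).val + 1), a i := by
  induction q generalizing off r with
  | zero => simpa [ofFun, find, sum] using ⟨h0, h1⟩
  | succ q ih =>
    have e : 2 ^ (q + 1) / 2 = 2 ^ q := by rw [pow_succ]; omega
    by_cases h : r < (ofFun a q off).sum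
    · have := ih r off h0 h
      simp only [ofFun, find, e, h, bind_val, op_val, decide_true, if_true]
      refine ⟨this.1, this.2.1.trans_le ?_, this.2.2⟩
      rw [pow_succ]; omega
    · rw [sum_ofFun_succ] at h1
      have := ih (r - (ofFun a q off).sum) (off + 2 ^ q) (by linarith [not_lt.1 h])
        (by linarith)
      simp only [ofFun, find, e, h, bind_val, op_val, decide_false, if_false, Bool.false_eq_true]
      generalize ((ofFun a q (off + 2 ^ q)).find (r - (ofFun a q off).sum) (off + 2 ^ q)
        (2 ^ q)).val = l at *
      obtain ⟨h2, h3, h4, h5⟩ := this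
      rw [sum_ofFun] at h4 h5
      refine ⟨by omega, by rw [pow_succ]; omega, ?_, ?_⟩
      · rw [← Finset.sum_Ico_consecutive a (show off ≤ off + 2 ^ q by omega) h2]
        linarith
      · rw [← Finset.sum_Ico_consecutive a (show off ≤ off + 2 ^ q by omega)
          (show off + 2 ^ q ≤ l + 1 by omega)]
        linarith

/-- The cost of updating the positions `lo, …, hi - 1` in a complete tree of depth `q`. -/
def updateCost : (q lo hi off : ℕ) → ℕ
  | 0, _, _, _ => 2
  | q + 1, lo, hi, off =>
    9 + if hi ≤ off + 2 ^ q then updateCost q lo hi off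
      else if off + 2 ^ q ≤ lo then updateCost q lo hi (off + 2 ^ q)
      else updateCost q lo (off + 2 ^ q) off + updateCost q (off + 2 ^ q) hi (off + 2 ^ q)

/-- A node is visited only if its positions meet `[lo, hi)`, so the cost is linear in `hi - lo`,
plus a multiple of the depth for each end of the interval that is not an end of the tree. -/
lemma updateCost_add_le (q lo hi off : ℕ) (h1 : off ≤ lo) (h2 : lo < hi) (h3 : hi ≤ off + 2 ^ q) :
    updateCost q lo hi off + 9 ≤ 18 * (hi - lo)
      + 9 * q * ((if lo = off then 0 else 1) + if hi = off + 2 ^ q then 0 else 1) := by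
  induction q generalizing lo hi off with
  | zero =>
    simp only [updateCost, pow_zero] at *
    omega
  | succ q ih =>
    have hp : 0 < 2 ^ q := by positivity
    rw [pow_succ] at *
    have key : ∀ x y : ℕ, x ≤ y → 9 * q * x ≤ 9 * q * y := fun x y h => Nat.mul_le_mul_left _ h
    rw [updateCost, show 9 * (q + 1) = 9 * q + 9 by ring, add_mul]
    split_ifs with c1 c2 c3 c4 c5 c6
    all_goals first
      | omega
      | skip
    all_goals try (have := ih lo hi off h1 h2 (by omega); split_ifs at this <;> omega)
    all_goals try
      (have := ih lo hi (off + 2 ^ q) (by omega) h2 (by omega); split_ifs at this <;> omega)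
    all_goals
      have e1 := ih lo (off + 2 ^ q) off h1 (by omega) le_rfl
      have e2 := ih (off + 2 ^ q) hi (off + 2 ^ q) le_rfl (by omega) (by omega)
      split_ifs at e1 e2 <;> omega

lemma updateCost_le (q lo hi off : ℕ) (h1 : off ≤ lo) (h2 : lo < hi) (h3 : hi ≤ off + 2 ^ q) :
    updateCost q lo hi off ≤ 18 * (hi - lo) + 18 * q := by
  have h := updateCost_add_le q lo hi off h1 h2 h3
  have : 9 * q * ((if lo = off then 0 else 1) + if hi = off + 2 ^ q then 0 else 1)
      ≤ 9 * q * 2 := by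
    gcongr
    split_ifs <;> omega
  omega

lemma update_ofFun_time (a a' : ℕ → ℝ) (q lo hi off : ℕ) :
    (update a' (ofFun a q off) lo hi off (2 ^ q)).time = updateCost q lo hi off := by
  induction q generalizing lo hi off with
  | zero => simp [ofFun, update, updateCost]
  | succ q ih =>
    have e : 2 ^ (q + 1) / 2 = 2 ^ q := by rw [pow_succ]; omega
    by_cases h1 : hi ≤ off + 2 ^ q
    · simp [ofFun, update, updateCost, e, h1, ih]; omega
    · by_cases h2 : off + 2 ^ q ≤ lo
      · simp [ofFun, update, updateCost, e, h1, h2, ih]; omega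
      · simp [ofFun, update, updateCost, e, h1, h2, ih]; omega

lemma ofFun_congr {a a' : ℕ → ℝ} {q off : ℕ}
    (h : ∀ i, off ≤ i → i < off + 2 ^ q → a i = a' i) : ofFun a q off = ofFun a' q off := by
  induction q generalizing off with
  | zero => simp [ofFun, h off le_rfl (by simp)]
  | succ q ih =>
    rw [pow_succ] at h
    simp only [ofFun]
    rw [ih fun i _ _ => h i (by omega) (by omega),
      ih (off := off + 2 ^ q) fun i _ _ => h i (by omega) (by omega)]

lemma update_ofFun_val (a a' : ℕ → ℝ) (q lo hi off : ℕ) (h1 : off ≤ lo) (h2 : lo < hi)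
    (h3 : hi ≤ off + 2 ^ q) (h : ∀ i, i < lo ∨ hi ≤ i → a i = a' i) :
    (update a' (ofFun a q off) lo hi off (2 ^ q)).val = ofFun a' q off := by
  induction q generalizing lo hi off a with
  | zero => simp [ofFun, update]
  | succ q ih =>
    have e : 2 ^ (q + 1) / 2 = 2 ^ q := by rw [pow_succ]; omega
    have hp : 2 ^ (q + 1) = 2 ^ q + 2 ^ q := by rw [pow_succ]; omega
    by_cases c1 : hi ≤ off + 2 ^ q
    · have e1 := ih a lo hi off h1 h2 c1 h
      have e2 : ofFun a q (off + 2 ^ q) = ofFun a' q (off + 2 ^ q) :=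
        ofFun_congr fun i _ _ => h i (by omega)
      simp [ofFun, update, e, c1, e1, e2]
    · by_cases c2 : off + 2 ^ q ≤ lo
      · have e1 := ih a lo hi (off + 2 ^ q) c2 h2 (by omega) h
        have e2 : ofFun a q off = ofFun a' q off :=
          ofFun_congr fun i _ _ => h i (by omega)
        simp [ofFun, update, e, c1, c2, e1, e2]
      · push Not at c1 c2
        have e1 := ih (fun i => if i < off + 2 ^ q then a i else a' i) lo (off + 2 ^ q) off h1 c2
          le_rfl (fun i hi' => by
            by_cases hi'' : i < off + 2 ^ q
            · simp [hi'', h i (by omega)]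
            · simp [hi''])
        have e2 := ih (fun i => if i < off + 2 ^ q then a' i else a i) (off + 2 ^ q) hi
          (off + 2 ^ q) le_rfl c1 (by omega) (fun i hi' => by
            by_cases hi'' : i < off + 2 ^ q
            · simp [hi'']
            · simp [hi'', h i (by omega)])
        rw [ofFun_congr (a' := a) (fun i _ h' => by simp [h'])] at e1
        rw [ofFun_congr (a' := a) (fun i h' _ => by simp [not_lt.2 h'])] at e2
        simp [ofFun, update, e, not_le.2 c1, not_le.2 c2, e1, e2]

end SumTree

/-! ### The seeding loop in terms of the chosen centers -/

/-- The `z`-th power of the distance between the points `i` and `c` on the line. -/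
noncomputable def powDist (y : ℕ → ℝ) (z : ℝ) (i c : ℕ) : ℝ := |y i - y c| ^ z

/-- The array of weights when the centers are `c₁` (the first one) and the members of `ls`: the
`z`-th power of the distance to the closest center, and `0` outside `{0, …, n - 1}`. -/
noncomputable def weight (n : ℕ) (y : ℕ → ℝ) (z : ℝ) (c₁ : ℕ) : List ℕ → ℕ → ℝ
  | [], i => if i < n then powDist y z i c₁ else 0
  | l :: ls, i => min (weight n y z c₁ ls i) (if i < n then powDist y z i l else 0)

section Weights

variable {n : ℕ} {y : ℕ → ℝ} {z : ℝ} {c₁ : ℕ} {ls : List ℕ}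

lemma powDist_nonneg (i c : ℕ) : 0 ≤ powDist y z i c := Real.rpow_nonneg (abs_nonneg _) _

lemma powDist_self (hz : 1 ≤ z) (i : ℕ) : powDist y z i i = 0 := by
  simp [powDist, Real.zero_rpow (by linarith : z ≠ 0)]

lemma powDist_le_iff (hz : 1 ≤ z) {i c i' c' : ℕ} :
    powDist y z i c ≤ powDist y z i' c' ↔ |y i - y c| ≤ |y i' - y c'| :=
  Real.rpow_le_rpow_iff (abs_nonneg _) (abs_nonneg _) (by linarith)

lemma powDist_lt_iff (hz : 1 ≤ z) {i c i' c' : ℕ} :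
    powDist y z i c < powDist y z i' c' ↔ |y i - y c| < |y i' - y c'| :=
  Real.rpow_lt_rpow_iff (abs_nonneg _) (abs_nonneg _) (by linarith)

lemma weight_of_le {i : ℕ} (hi : n ≤ i) : weight n y z c₁ ls i = 0 := by
  induction ls with
  | nil => simp [weight, not_lt.2 hi]
  | cons l ls ih => simp [weight, not_lt.2 hi, ih]

lemma weight_nonneg (i : ℕ) : 0 ≤ weight n y z c₁ ls i := by
  induction ls with
  | nil => simp only [weight]; split_ifs; exacts [powDist_nonneg _ _, le_rfl]
  | cons l ls ih =>
    refine le_min ih ?_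
    split_ifs; exacts [powDist_nonneg _ _, le_rfl]

lemma weight_le {i c : ℕ} (hi : i < n) (hc : c ∈ c₁ :: ls) :
    weight n y z c₁ ls i ≤ powDist y z i c := by
  induction ls with
  | nil =>
    obtain rfl : c = c₁ := by simpa using hc
    simp [weight, hi]
  | cons l ls ih =>
    simp only [weight, hi, if_true]
    rcases eq_or_ne c l with rfl | h
    · exact min_le_right _ _
    · exact (min_le_left _ _).trans (ih (by simp_all))

lemma exists_weight_eq {i : ℕ} (hi : i < n) :
    ∃ c ∈ c₁ :: ls, weight n y z c₁ ls i = powDist y z i c := by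
  induction ls with
  | nil => exact ⟨c₁, by simp, by simp [weight, hi]⟩
  | cons l ls ih =>
    obtain ⟨c, hc, e⟩ := ih
    simp only [weight, hi, if_true]
    rcases min_choice (weight n y z c₁ ls i) (powDist y z i l) with h | h
    · refine ⟨c, ?_, h.trans e⟩
      simp only [List.mem_cons] at hc ⊢; tauto
    · exact ⟨l, by simp, h⟩

/-- If a new center `l` is not closer to the point `i` than the old centers, then it is not closer
to any point `i'` beyond `i`, as seen from `l`. This is why the scans may stop. -/
lemma weight_le_of_between (hz : 1 ≤ z) {i i' l : ℕ} (hi : i < n) (hi' : i' < n)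
    (hb : |y i' - y l| = |y i' - y i| + |y i - y l|)
    (h : weight n y z c₁ ls i ≤ powDist y z i l) :
    weight n y z c₁ ls i' ≤ powDist y z i' l := by
  obtain ⟨c, hc, e⟩ := exists_weight_eq (y := y) (z := z) (c₁ := c₁) (ls := ls) hi
  refine (weight_le hi' hc).trans ?_
  rw [e, powDist_le_iff hz] at h
  rw [powDist_le_iff hz, hb]
  exact (abs_sub_le _ (y i) _).trans (by linarith)

end Weights

/-- The end of the scan to the left from `m - 1`, which goes on as long as `P` holds. -/
def leftEnd (P : ℕ → Bool) : ℕ → ℕ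
  | 0 => 0
  | i + 1 => if P i then leftEnd P i else i + 1

/-- The end of the scan to the right from `j`, which goes on as long as `P` holds, up to `n`. -/
def rightEnd (n : ℕ) (P : ℕ → Bool) : (fuel : ℕ) → (j : ℕ) → ℕ
  | 0, j => j
  | f + 1, j => if j < n then (if P j then rightEnd n P f (j + 1) else j) else j

section Ends

lemma leftEnd_spec (P : ℕ → Bool) (m : ℕ) :
    leftEnd P m ≤ m ∧ (∀ i, leftEnd P m ≤ i → i < m → P i) ∧
    (leftEnd P m ≠ 0 → P (leftEnd P m - 1) = false) := by
  induction m with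
  | zero => simp [leftEnd]
  | succ m ih =>
    by_cases h : P m = true
    · simp only [leftEnd, h, if_true]
      refine ⟨by omega, fun i hi hi' => ?_, ih.2.2⟩
      rcases Nat.lt_succ_iff_lt_or_eq.1 hi' with h' | rfl
      · exact ih.2.1 i hi h'
      · exact h
    · simp only [leftEnd, h]
      exact ⟨le_rfl, fun i hi hi' => absurd hi' (by simpa using hi), fun _ => by simpa using h⟩

lemma rightEnd_spec (n : ℕ) (P : ℕ → Bool) (f j : ℕ) (hj : j ≤ n) (hf : n < j + f) :
    j ≤ rightEnd n P f j ∧ rightEnd n P f j ≤ n ∧ (∀ i, j ≤ i → i < rightEnd n P f j → P i) ∧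
    (rightEnd n P f j ≠ n → P (rightEnd n P f j) = false) := by
  induction f generalizing j with
  | zero => omega
  | succ f ih =>
    by_cases hjn : j < n
    · by_cases h : P j = true
      · simp only [rightEnd, h, hjn, if_true]
        obtain ⟨h1, h2, h3, h4⟩ := ih (j + 1) (by omega) (by omega)
        refine ⟨by omega, h2, fun i hi hi' => ?_, h4⟩
        rcases eq_or_lt_of_le hi with rfl | h'
        · exact h
        · exact h3 i h' hi'
      · simp only [rightEnd, h, hjn, if_true]
        exact ⟨le_rfl, hj, fun i hi hi' => absurd hi' (by simpa using hi),
          fun _ => by simpa using h⟩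
    · simp only [rightEnd, hjn, if_false]
      exact ⟨le_rfl, hj, fun i hi hi' => absurd hi' (by simpa using hi), fun _ => by omega⟩

lemma leftEnd_congr {P P' : ℕ → Bool} (m : ℕ) (h : ∀ i < m, P i = P' i) :
    leftEnd P m = leftEnd P' m := by
  induction m with
  | zero => rfl
  | succ m ih => simp only [leftEnd, h m (Nat.lt_succ_self m), ih fun i hi => h i (by omega)]

lemma rightEnd_congr {n : ℕ} {P P' : ℕ → Bool} (f j : ℕ) (h : ∀ i, j ≤ i → P i = P' i) :
    rightEnd n P f j = rightEnd n P' f j := by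
  induction f generalizing j with
  | zero => rfl
  | succ f ih => simp only [rightEnd, h j le_rfl, ih (j + 1) fun i hi => h i (by omega)]

lemma scanLeft_eq (y : ℕ → ℝ) (z : ℝ) (c m : ℕ) (a : ℕ → ℝ) (lo : ℕ)
    (hlo : lo = leftEnd (fun i => decide (powDist y z i c < a i)) m) :
    (scanLeft y z c m a).val = (lo, fun i => if lo ≤ i ∧ i < m then powDist y z i c else a i) ∧
    (scanLeft y z c m a).time = 9 * (m - lo) + if lo = 0 then 1 else 8 := by
  subst hlo
  induction m generalizing a with
  | zero => simp [scanLeft, leftEnd]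
  | succ m ih =>
    by_cases h : powDist y z m c < a m
    · have e : leftEnd (fun i => decide (powDist y z i c < Function.update a m (powDist y z m c) i))
          m = leftEnd (fun i => decide (powDist y z i c < a i)) m := by
        refine leftEnd_congr m fun i hi => ?_
        rw [Function.update_of_ne hi.ne]
      have hl := (leftEnd_spec (fun i => decide (powDist y z i c < a i)) m).1
      have := ih (Function.update a m (powDist y z m c))
      rw [e] at this
      have h' : |y m - y c| ^ z < a m := h
      simp only [scanLeft, leftEnd, bind_val, bind_time, distPow_val, distPow_time, rd_val, op_val,
        op_time, rd_time, wr_val, wr_time, tick_time, h', h, decide_true, if_true]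
      rw [show |y m - y c| ^ z = powDist y z m c from rfl, this.1, this.2]
      refine ⟨?_, by omega⟩
      refine Prod.ext rfl (funext fun i => ?_)
      simp only [Function.update_apply]
      rcases lt_trichotomy i m with hi | rfl | hi
      · simp [hi, hi.ne, Nat.lt_succ_of_lt hi]
      · simp [hl]
      · rw [if_neg (by omega), if_neg (by omega), if_neg (by omega)]
    · have h' : ¬ |y m - y c| ^ z < a m := h
      simp only [scanLeft, leftEnd, bind_val, bind_time, distPow_val, distPow_time, rd_val, op_val,
        op_time, rd_time, tick_time, h', h, decide_false, if_false, Bool.false_eq_true, pure_val,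
        pure_time]
      refine ⟨Prod.ext rfl (funext fun i => ?_), by simp⟩
      dsimp only
      rw [if_neg (by omega)]

lemma scanRight_eq (n : ℕ) (y : ℕ → ℝ) (z : ℝ) (c f j : ℕ) (a : ℕ → ℝ) (hi : ℕ)
    (hj : j ≤ n) (hf : n < j + f)
    (hhi : hi = rightEnd n (fun i => decide (powDist y z i c < a i)) f j) :
    (scanRight n y z c f j a).val
      = (hi, fun i => if j ≤ i ∧ i < hi then powDist y z i c else a i) ∧
    (scanRight n y z c f j a).time = 10 * (hi - j) + if hi = n then 1 else 8 := by
  subst hhi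
  induction f generalizing a j with
  | zero => omega
  | succ f ih =>
    by_cases hjn : j < n
    · by_cases h : powDist y z j c < a j
      · have e : rightEnd n (fun i => decide (powDist y z i c
            < Function.update a j (powDist y z j c) i)) f (j + 1)
            = rightEnd n (fun i => decide (powDist y z i c < a i)) f (j + 1) := by
          refine rightEnd_congr f (j + 1) fun i hi => ?_
          rw [Function.update_of_ne (by omega)]
        have hl := (rightEnd_spec n (fun i => decide (powDist y z i c < a i)) f (j + 1)
          hjn (by omega)).1
        have := ih (j + 1) (Function.update a j (powDist y z j c)) hjn (by omega)
        rw [e] at this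
        have h' : |y j - y c| ^ z < a j := h
        simp only [scanRight, rightEnd, bind_val, bind_time, distPow_val, distPow_time, rd_val,
          op_val, op_time, rd_time, wr_val, wr_time, h', h, hjn, decide_true, if_true]
        rw [show |y j - y c| ^ z = powDist y z j c from rfl, this.1, this.2]
        refine ⟨?_, by omega⟩
        refine Prod.ext rfl (funext fun i => ?_)
        simp only [Function.update_apply]
        rcases lt_trichotomy i j with hi | rfl | hi
        · rw [if_neg (by omega), if_neg (by omega), if_neg (by omega)]
        · rw [if_neg (by omega), if_pos rfl, if_pos (by omega)]
        · simp only [hi.ne', if_false, Nat.succ_le_iff, hi, hi.le]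
      · have h' : ¬ |y j - y c| ^ z < a j := h
        simp only [scanRight, rightEnd, bind_val, bind_time, distPow_val, distPow_time, rd_val,
          op_val, op_time, rd_time, h', h, hjn, decide_false, decide_true, if_true, if_false,
          Bool.false_eq_true, pure_val, pure_time]
        refine ⟨Prod.ext rfl (funext fun i => ?_), by simp [hjn.ne]⟩
        dsimp only
        rw [if_neg (by omega)]
    · simp only [scanRight, rightEnd, bind_val, bind_time, op_val, op_time, hjn, decide_false,
        if_false, Bool.false_eq_true, pure_val, pure_time]
      refine ⟨Prod.ext rfl (funext fun i => ?_), ?_⟩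
      · dsimp only
        rw [if_neg (by omega)]
      · rw [if_pos (by omega)]; simp

end Ends

/-! ### One round of seeding -/

/-- The sampling step of a round, for the weights `a`. -/
noncomputable def pick (n q : ℕ) (a : ℕ → ℝ) (u : ℝ) : Timed ℕ := do
  tick
  let total ← op (SumTree.ofFun a q 0).sum
  let pos ← op (decide (0 < total))
  if pos then do
    let r ← op (u * total)
    (SumTree.ofFun a q 0).find r 0 (2 ^ q)
  else drawIndex n u

/-- Whether the new center `l` is closer to the point `i` than the old centers. -/
noncomputable def closer (n : ℕ) (y : ℕ → ℝ) (z : ℝ) (c₁ : ℕ) (ls : List ℕ) (l i : ℕ) : Bool :=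
  decide (powDist y z i l < weight n y z c₁ ls i)

/-- The cost of a round in which the new center is `l` and the scans end at `lo` and `hi`, without
the sampling step. -/
def scanCost (n q l lo hi : ℕ) : ℕ :=
  1 + ((9 * (l - lo) + if lo = 0 then 1 else 8) + (1 + ((10 * (hi - (l + 1)) +
    if hi = n then 1 else 8) + (SumTree.updateCost q lo hi 0 + 1))))

/-- The cost of a round in which the new center is `l`, without the sampling step. -/
noncomputable def roundCost (n q : ℕ) (y : ℕ → ℝ) (z : ℝ) (c₁ : ℕ) (ls : List ℕ) (l : ℕ) : ℕ :=
  scanCost n q l (leftEnd (closer n y z c₁ ls l) l) (rightEnd n (closer n y z c₁ ls l) n (l + 1))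

/-- The seeding loop, with a state that consists of the chosen centers only. -/
noncomputable def seedModel (n q : ℕ) (y : ℕ → ℝ) (z : ℝ) (c₁ : ℕ) :
    (m : ℕ) → (u : Fin m → ℝ) → List ℕ → Timed (List ℕ)
  | 0, _, ls => pure (ls ++ [c₁])
  | m + 1, u, ls => do
      let l ← pick n q (weight n y z c₁ ls) (u 0)
      let _ ← (⟨(), roundCost n q y z c₁ ls l⟩ : Timed Unit)
      seedModel n q y z c₁ m (Fin.tail u) (l :: ls)

section Round

variable {n q : ℕ} {y : ℕ → ℝ} {z : ℝ} {c₁ : ℕ} {ls : List ℕ}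

lemma sum_ofFun_weight (hn : n ≤ 2 ^ q) :
    (SumTree.ofFun (weight n y z c₁ ls) q 0).sum
      = ∑ i ∈ Finset.range n, weight n y z c₁ ls i := by
  rw [SumTree.sum_ofFun, zero_add, Finset.range_eq_Ico,
    ← Finset.sum_Ico_consecutive _ (Nat.zero_le n) hn, add_eq_left]
  exact Finset.sum_eq_zero fun i hi => weight_of_le (Finset.mem_Ico.1 hi).1

lemma pick_val_of_pos {a : ℕ → ℝ} {u : ℝ} (h : 0 < (SumTree.ofFun a q 0).sum) :
    (pick n q a u).val
      = ((SumTree.ofFun a q 0).find (u * (SumTree.ofFun a q 0).sum) 0 (2 ^ q)).val := by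
  simp [pick, h]

lemma pick_val_of_nonpos {a : ℕ → ℝ} {u : ℝ} (h : ¬ 0 < (SumTree.ofFun a q 0).sum) :
    (pick n q a u).val = ⌊u * n⌋₊ := by
  simp [pick, h, drawIndex]

lemma floor_mul_lt {u : ℝ} (hn : 1 ≤ n) (hu : u ∈ Set.Ico (0 : ℝ) 1) : ⌊u * n⌋₊ < n := by
  have : (0 : ℝ) < n := by exact_mod_cast hn
  rw [Nat.floor_lt (mul_nonneg hu.1 this.le)]
  nlinarith [hu.2]

lemma pick_lt (hn : 1 ≤ n) {u : ℝ} (hu : u ∈ Set.Ico (0 : ℝ) 1) :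
    (pick n q (weight n y z c₁ ls) u).val < n := by
  by_cases h : 0 < (SumTree.ofFun (weight n y z c₁ ls) q 0).sum
  · rw [pick_val_of_pos h]
    obtain ⟨-, -, h3, h4⟩ := SumTree.find_ofFun_val (weight n y z c₁ ls) q
      (u * (SumTree.ofFun (weight n y z c₁ ls) q 0).sum) 0 (mul_nonneg hu.1 h.le)
      (by nlinarith [hu.2])
    by_contra hc
    rw [Finset.sum_Ico_succ_top (Nat.zero_le _), weight_of_le (not_lt.1 hc), add_zero] at h4
    linarith
  · rw [pick_val_of_nonpos h]
    exact floor_mul_lt hn hu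

lemma pick_time (a : ℕ → ℝ) (u : ℝ) : (pick n q a u).time ≤ 6 * q + 5 := by
  by_cases h : 0 < (SumTree.ofFun a q 0).sum
  · have := SumTree.find_ofFun_time a q (u * (SumTree.ofFun a q 0).sum) 0
    simp [pick, h]; omega
  · simp [pick, h, drawIndex]

lemma ends_spec {l : ℕ} (hl : l < n) :
    leftEnd (closer n y z c₁ ls l) l ≤ l ∧
    l < rightEnd n (closer n y z c₁ ls l) n (l + 1) ∧
    rightEnd n (closer n y z c₁ ls l) n (l + 1) ≤ n := by
  have h2 := rightEnd_spec n (closer n y z c₁ ls l) n (l + 1) hl (by omega)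
  exact ⟨(leftEnd_spec _ _).1, h2.1, h2.2.1⟩

lemma roundCost_le (hn : n ≤ 2 ^ q) {l : ℕ} (hl : l < n) :
    roundCost n q y z c₁ ls l ≤ 28 * (rightEnd n (closer n y z c₁ ls l) n (l + 1)
      - leftEnd (closer n y z c₁ ls l) l) + 18 * q + 19 := by
  obtain ⟨h1, h2, h3⟩ := ends_spec (y := y) (z := z) (c₁ := c₁) (ls := ls) hl
  unfold roundCost scanCost
  have := SumTree.updateCost_le q _ _ 0 (Nat.zero_le _) (h1.trans_lt h2)
    (by rw [zero_add]; exact h3.trans hn)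
  split_ifs <;> omega

/-- All scanned points except `l` itself are closer to the new center than to the old ones. -/
lemma ends_sub_le {l : ℕ} (hl : l < n) :
    rightEnd n (closer n y z c₁ ls l) n (l + 1) - leftEnd (closer n y z c₁ ls l) l
      ≤ 1 + ∑ i ∈ Finset.range n,
          if powDist y z i l < weight n y z c₁ ls i then 1 else 0 := by
  obtain ⟨h1, h2, h3⟩ := ends_spec (y := y) (z := z) (c₁ := c₁) (ls := ls) hl
  have hL := (leftEnd_spec (closer n y z c₁ ls l) l).2.1
  have hR := (rightEnd_spec n (closer n y z c₁ ls l) n (l + 1) hl (by omega)).2.2.1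
  rw [← Finset.card_filter, ← Nat.card_Ico, add_comm 1]
  rw [← Finset.card_erase_add_one (Finset.mem_Ico.2 ⟨h1, h2⟩)]
  gcongr
  intro i hi
  simp only [Finset.mem_erase, Finset.mem_Ico, Finset.mem_filter, Finset.mem_range] at hi ⊢
  refine ⟨by omega, ?_⟩
  have : closer n y z c₁ ls l i = true := by
    rcases lt_or_gt_of_ne hi.1 with h | h
    · exact hL i hi.2.1 h
    · exact hR i h hi.2.2
  simpa [closer] using this

/-- After the two scans the array holds the weights for the enlarged set of centers. -/
lemma scanned_eq_weight (hz : 1 ≤ z) (hy : ∀ i j, i ≤ j → j < n → y i ≤ y j) {l : ℕ} (hl : l < n)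
    (i : ℕ) :
    (if l + 1 ≤ i ∧ i < rightEnd n (closer n y z c₁ ls l) n (l + 1) then powDist y z i l
      else if leftEnd (closer n y z c₁ ls l) l ≤ i ∧ i < l then powDist y z i l
      else Function.update (weight n y z c₁ ls) l 0 i) = weight n y z c₁ (l :: ls) i := by
  obtain ⟨h1, hL, hL'⟩ := leftEnd_spec (closer n y z c₁ ls l) l
  obtain ⟨h2, h3, hR, hR'⟩ := rightEnd_spec n (closer n y z c₁ ls l) n (l + 1) hl (by omega)
  generalize rightEnd n (closer n y z c₁ ls l) n (l + 1) = hi at *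
  generalize leftEnd (closer n y z c₁ ls l) l = lo at *
  simp only [closer, decide_eq_true_eq, decide_eq_false_iff_not, not_lt] at *
  simp only [weight]
  split_ifs with c1 c2 c3 c4 c5
  · exact (min_eq_right (hR i c1.1 c1.2).le).symm
  · omega
  · exact (min_eq_right (hL i c3.1 c3.2).le).symm
  · omega
  · rcases lt_trichotomy i l with h | rfl | h
    · rw [Function.update_of_ne h.ne, eq_comm, min_eq_left]
      have hlo : lo ≠ 0 := by omega
      refine weight_le_of_between hz (i := lo - 1) (by omega) c5 ?_ (hL' hlo)
      have e1 := hy i (lo - 1) (by omega) (by omega)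
      have e2 := hy (lo - 1) l (by omega) hl
      rw [abs_of_nonpos, abs_of_nonpos, abs_of_nonpos] <;> linarith
    · rw [Function.update_self, powDist_self hz, min_eq_right (weight_nonneg _)]
    · rw [Function.update_of_ne h.ne', eq_comm, min_eq_left]
      have hlo : hi ≠ n := by omega
      refine weight_le_of_between hz (i := hi) (by omega) c5 ?_ (hR' hlo)
      have e1 := hy hi i (by omega) c5
      have e2 := hy l hi (by omega) (by omega)
      rw [abs_of_nonneg, abs_of_nonneg, abs_of_nonneg] <;> linarith
  · rw [Function.update_of_ne (by omega), weight_of_le (not_lt.1 c5), min_self]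

/-- On sorted points the seeding loop does what the model says. -/
lemma seedLoop_eq (hz : 1 ≤ z) (hy : ∀ i j, i ≤ j → j < n → y i ≤ y j) (hn : 1 ≤ n)
    (hq : n ≤ 2 ^ q) (m : ℕ) (u : Fin m → ℝ) (hu : ∀ t, u t ∈ Set.Ico (0 : ℝ) 1) (ls : List ℕ) :
    seedLoop n y z (2 ^ q) m u (weight n y z c₁ ls) (SumTree.ofFun (weight n y z c₁ ls) q 0)
      (ls ++ [c₁]) = seedModel n q y z c₁ m u ls := by
  induction m generalizing ls with
  | zero => rfl
  | succ m ih =>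
    have hl := pick_lt (q := q) (y := y) (z := z) (c₁ := c₁) (ls := ls) hn (hu 0)
    -- both branches of the sampling step continue in the same way
    have hsplit : seedLoop n y z (2 ^ q) (m + 1) u (weight n y z c₁ ls)
        (SumTree.ofFun (weight n y z c₁ ls) q 0) (ls ++ [c₁]) = (do
          let l ← pick n q (weight n y z c₁ ls) (u 0)
          let a ← wr (weight n y z c₁ ls) l 0
          let (lo, a) ← scanLeft y z l l a
          let j ← op (l + 1)
          let (hi, a) ← scanRight n y z l n j a
          let S ← (SumTree.ofFun (weight n y z c₁ ls) q 0).update a lo hi 0 (2 ^ q)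
          let ls ← op (l :: (ls ++ [c₁]))
          seedLoop n y z (2 ^ q) m (Fin.tail u) a S ls) := by
      by_cases h : 0 < (SumTree.ofFun (weight n y z c₁ ls) q 0).sum
      · apply Timed.ext
        · simp only [seedLoop, pick, bind_val, op_val, h, decide_true, if_true]
        · simp only [seedLoop, pick, bind_time, bind_val, op_val, h, decide_true, if_true]
          ring
      · apply Timed.ext
        · simp only [seedLoop, pick, bind_val, op_val, h, decide_false, if_false,
            Bool.false_eq_true]
        · simp only [seedLoop, pick, bind_time, bind_val, op_val, h, decide_false, if_false,
            Bool.false_eq_true]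
          ring
    rw [hsplit, seedModel]
    generalize pick n q (weight n y z c₁ ls) (u 0) = p at *
    obtain ⟨l, t⟩ := p
    dsimp only at hl
    obtain ⟨h1, h2, h3⟩ := ends_spec (y := y) (z := z) (c₁ := c₁) (ls := ls) hl
    have eL := scanLeft_eq y z l l (Function.update (weight n y z c₁ ls) l 0)
      (leftEnd (closer n y z c₁ ls l) l) (leftEnd_congr _ fun i hi => by
        rw [Function.update_of_ne hi.ne]; rfl)
    set lo := leftEnd (closer n y z c₁ ls l) l with hlo
    have eR := scanRight_eq n y z l n (l + 1)
      (fun i => if lo ≤ i ∧ i < l then powDist y z i l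
        else Function.update (weight n y z c₁ ls) l 0 i)
      (rightEnd n (closer n y z c₁ ls l) n (l + 1)) hl (by omega) (rightEnd_congr _ _ fun i hi => by
        rw [if_neg (by omega), Function.update_of_ne (by omega)]; rfl)
    have eW := funext (scanned_eq_weight (c₁ := c₁) (ls := ls) hz hy hl)
    rw [← hlo] at eW
    rw [eW] at eR
    have eU : ((SumTree.ofFun (weight n y z c₁ ls) q 0).update (weight n y z c₁ (l :: ls)) lo
        (rightEnd n (closer n y z c₁ ls l) n (l + 1)) 0 (2 ^ q)).val
        = SumTree.ofFun (weight n y z c₁ (l :: ls)) q 0 := by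
      refine SumTree.update_ofFun_val _ _ _ _ _ _ (Nat.zero_le _) (by omega)
        (by rw [zero_add]; omega) fun i hi => ?_
      rw [← eW]
      dsimp only
      rw [if_neg (by omega), if_neg (by omega), Function.update_of_ne (by omega)]
    have eI := ih (Fin.tail u) (fun t => hu t.succ) (l :: ls)
    apply Timed.ext
    · simp only [bind_val, wr_val, eL.1, op_val, eR.1, eU]
      exact congrArg Timed.val eI
    · simp only [bind_time, wr_val, wr_time, eL.1, eL.2, op_val, op_time, eR.1, eR.2, eU,
        SumTree.update_ofFun_time]
      rw [← eI]
      simp only [roundCost, scanCost, ← hlo, List.cons_append]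
      ring

lemma seedModel_length (m : ℕ) (u : Fin m → ℝ) (ls : List ℕ) :
    (seedModel n q y z c₁ m u ls).val.length = m + ls.length + 1 := by
  induction m generalizing ls with
  | zero => simp [seedModel]
  | succ m ih => simp [seedModel, ih]; omega

end Round

/-- The number of rounds in which the weight of the point `i` decreases. -/
noncomputable def hits (n q : ℕ) (y : ℕ → ℝ) (z : ℝ) (c₁ i : ℕ) :
    (m : ℕ) → (u : Fin m → ℝ) → List ℕ → ℕ
  | 0, _, _ => 0
  | m + 1, u, ls =>
    (if powDist y z i (pick n q (weight n y z c₁ ls) (u 0)).val < weight n y z c₁ ls i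
      then 1 else 0)
      + hits n q y z c₁ i m (Fin.tail u) ((pick n q (weight n y z c₁ ls) (u 0)).val :: ls)

section Total

variable {n q : ℕ} {y : ℕ → ℝ} {z : ℝ} {c₁ : ℕ}

lemma seedModel_time_le_hits (hn : 1 ≤ n) (hq : n ≤ 2 ^ q) (m : ℕ) (u : Fin m → ℝ)
    (hu : ∀ t, u t ∈ Set.Ico (0 : ℝ) 1) (ls : List ℕ) :
    (seedModel n q y z c₁ m u ls).time
      ≤ 52 * (m * (q + 1)) + 28 * ∑ i ∈ Finset.range n, hits n q y z c₁ i m u ls := by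
  induction m generalizing ls with
  | zero => simp [seedModel]
  | succ m ih =>
    have hl := pick_lt (q := q) (y := y) (z := z) (c₁ := c₁) (ls := ls) hn (hu 0)
    have ht := pick_time (n := n) (q := q) (weight n y z c₁ ls) (u 0)
    simp only [seedModel, hits, bind_time, Finset.sum_add_distrib]
    generalize pick n q (weight n y z c₁ ls) (u 0) = p at *
    have e1 := roundCost_le (y := y) (z := z) (c₁ := c₁) (ls := ls) hq hl
    have e2 := ends_sub_le (y := y) (z := z) (c₁ := c₁) (ls := ls) hl
    have e3 := ih (Fin.tail u) (fun t => hu t.succ) (p.val :: ls)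
    rw [add_mul m 1]
    omega

lemma seedModel_time_le (hn : 1 ≤ n) (hq : n ≤ 2 ^ q) (m : ℕ) (u : Fin m → ℝ)
    (hu : ∀ t, u t ∈ Set.Ico (0 : ℝ) 1) (ls : List ℕ) :
    (seedModel n q y z c₁ m u ls).time ≤ m * (28 * n + 24 * (q + 1)) := by
  induction m generalizing ls with
  | zero => simp [seedModel]
  | succ m ih =>
    have hl := pick_lt (q := q) (y := y) (z := z) (c₁ := c₁) (ls := ls) hn (hu 0)
    have ht := pick_time (n := n) (q := q) (weight n y z c₁ ls) (u 0)
    simp only [seedModel, bind_time]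
    generalize pick n q (weight n y z c₁ ls) (u 0) = p at *
    have e1 := roundCost_le (y := y) (z := z) (c₁ := c₁) (ls := ls) hq hl
    have e2 := ends_spec (y := y) (z := z) (c₁ := c₁) (ls := ls) hl
    have e3 := ih (Fin.tail u) (fun t => hu t.succ) (p.val :: ls)
    rw [add_mul m 1]
    omega

end Total

/-! ### Discretely measurable functions -/

/-- A function with countably many values, each of which is taken on a measurable set. No
measurable structure on the codomain is involved, so the notion applies to lists and arrays of
indices, and it is preserved by composition with arbitrary functions. -/
def DiscreteMeasurable {Ω α : Type*} [MeasurableSpace Ω] (f : Ω → α) : Prop :=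
  (Set.range f).Countable ∧ ∀ s, MeasurableSet (f ⁻¹' s)

namespace DiscreteMeasurable

variable {Ω α β : Type*} [MeasurableSpace Ω]

lemma const (a : α) : DiscreteMeasurable fun _ : Ω => a :=
  ⟨(Set.countable_singleton a).mono (by rintro _ ⟨ω, rfl⟩; rfl),
    fun _ => measurableSet_preimage measurable_const (by measurability)⟩

lemma map {f : Ω → α} (hf : DiscreteMeasurable f) (g : α → β) :
    DiscreteMeasurable fun ω => g (f ω) :=
  ⟨by rw [Set.range_comp' g f]; exact hf.1.image g, fun s => hf.2 (g ⁻¹' s)⟩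

/-- A function that is given piecewise, according to the value of `p`. -/
lemma piecewise {p : Ω → α} (hp : DiscreteMeasurable p) {F : α → Ω → β}
    (hF : ∀ a, DiscreteMeasurable (F a)) : DiscreteMeasurable fun ω => F (p ω) ω := by
  refine ⟨?_, fun s => ?_⟩
  · refine (hp.1.biUnion fun a _ => (hF a).1).mono ?_
    rintro _ ⟨ω, rfl⟩
    exact Set.mem_biUnion ⟨ω, rfl⟩ ⟨ω, rfl⟩
  · have : (fun ω => F (p ω) ω) ⁻¹' s
        = ⋃ a ∈ Set.range p, p ⁻¹' {a} ∩ F a ⁻¹' s := by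
      ext ω
      simp only [Set.mem_preimage, Set.mem_iUnion, Set.mem_inter_iff, Set.mem_singleton_iff,
        exists_prop]
      exact ⟨fun h => ⟨p ω, ⟨ω, rfl⟩, rfl, h⟩, fun ⟨a, _, h, h'⟩ => by rwa [h]⟩
    rw [this]
    exact MeasurableSet.biUnion hp.1 fun a _ => (hp.2 _).inter ((hF a).2 s)

lemma of_measurable [Countable α] [MeasurableSpace α] [MeasurableSingletonClass α] {f : Ω → α}
    (hf : Measurable f) : DiscreteMeasurable f :=
  ⟨Set.to_countable _, fun s => hf s.to_countable.measurableSet⟩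

lemma measurable [MeasurableSpace α] {f : Ω → α} (hf : DiscreteMeasurable f) : Measurable f :=
  fun s _ => hf.2 s

lemma decide {P : Ω → Prop} [DecidablePred P] (hP : MeasurableSet {ω | P ω}) :
    DiscreteMeasurable fun ω => Decidable.decide (P ω) := by
  refine of_measurable (measurable_to_bool ?_)
  convert hP using 1
  ext ω; simp

lemma ite {P : Ω → Prop} [DecidablePred P] (hP : MeasurableSet {ω | P ω}) {f g : Ω → α}
    (hf : DiscreteMeasurable f) (hg : DiscreteMeasurable g) :
    DiscreteMeasurable fun ω => if P ω then f ω else g ω := by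
  have := (decide hP).piecewise (F := fun b ω => if b then f ω else g ω)
    (by rintro (_ | _); exacts [hg, hf])
  simpa using this

lemma bind {α β : Type} {p : Ω → Timed α} (hp : DiscreteMeasurable p) {F : α → Ω → Timed β}
    (hF : ∀ a, DiscreteMeasurable (F a)) :
    DiscreteMeasurable fun ω => p ω >>= fun a => F a ω :=
  hp.piecewise (F := fun t ω => (⟨(F t.val ω).val, t.time + (F t.val ω).time⟩ : Timed β))
    fun t => (hF t.val).map fun r => (⟨r.val, t.time + r.time⟩ : Timed β)

/-- The first operation may have a continuum of results. -/
lemma op_bind {α β : Type} {r : Ω → α} {F : α → Ω → Timed β}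
    (h : DiscreteMeasurable fun ω => F (r ω) ω) :
    DiscreteMeasurable fun ω => Prone.op (r ω) >>= fun a => F a ω :=
  h.map fun t => (⟨t.val, 1 + t.time⟩ : Timed β)

lemma rd_bind {ι α β : Type} {A : Ω → ι → α} {i : ι} {F : α → Ω → Timed β}
    (h : DiscreteMeasurable fun ω => F (A ω i) ω) :
    DiscreteMeasurable fun ω => rd (A ω) i >>= fun a => F a ω :=
  h.map fun t => (⟨t.val, 1 + t.time⟩ : Timed β)

lemma op {α : Type} {f : Ω → α} (hf : DiscreteMeasurable f) :
    DiscreteMeasurable fun ω => Prone.op (f ω) := hf.map _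

end DiscreteMeasurable

/-! ### Measurability of the seeding procedure -/

section Measurability

variable {Ω : Type*} [MeasurableSpace Ω]

lemma discreteMeasurable_keyLe {x : Ω → ℕ → ℝ} (hx : ∀ i, Measurable fun ω => x ω i) (i j : ℕ) :
    DiscreteMeasurable fun ω => keyLe (x ω) i j :=
  (DiscreteMeasurable.decide (measurableSet_le (hx i) (hx j))).map
    fun b => (⟨b, 3⟩ : Timed Bool)

lemma discreteMeasurable_merge {le : Ω → ℕ → ℕ → Timed Bool}
    (hle : ∀ i j, DiscreteMeasurable fun ω => le ω i j) (p q : List ℕ) :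
    DiscreteMeasurable fun ω => merge (le ω) p q := by
  induction p, q using merge.induct with
  | case1 q => simpa only [merge] using DiscreteMeasurable.const _
  | case2 a p => simpa only [merge] using DiscreteMeasurable.const _
  | case3 a p b q ih1 ih2 =>
    simp only [merge]
    refine (DiscreteMeasurable.const tick).bind fun _ => (hle a b).bind fun c => ?_
    cases c
    · exact ih2.bind fun l => DiscreteMeasurable.const _
    · exact ih1.bind fun l => DiscreteMeasurable.const _

lemma discreteMeasurable_mergeSort {le : Ω → ℕ → ℕ → Timed Bool}
    (hle : ∀ i j, DiscreteMeasurable fun ω => le ω i j) (f : ℕ) (l : List ℕ) :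
    DiscreteMeasurable fun ω => mergeSort (le ω) f l := by
  induction f generalizing l with
  | zero => exact DiscreteMeasurable.const _
  | succ f ih =>
    match l with
    | [] => exact DiscreteMeasurable.const _
    | [a] => exact DiscreteMeasurable.const _
    | a :: b :: l =>
      simp only [mergeSort]
      refine (DiscreteMeasurable.const tick).bind fun _ =>
        (DiscreteMeasurable.const (split (a :: b :: l))).bind fun s => ?_
      exact (ih s.1).bind fun p => (ih s.2).bind fun q => discreteMeasurable_merge hle p q

lemma measurable_powDist {y : Ω → ℕ → ℝ} (hy : ∀ i, Measurable fun ω => y ω i) (z : ℝ)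
    (i c : ℕ) : Measurable fun ω => powDist (y ω) z i c := by
  unfold powDist
  exact (((hy i).sub (hy c)).abs).pow_const z

lemma measurable_weight {y : Ω → ℕ → ℝ} (hy : ∀ i, Measurable fun ω => y ω i) (n : ℕ) (z : ℝ)
    (c₁ : ℕ) (ls : List ℕ) (i : ℕ) : Measurable fun ω => weight n (y ω) z c₁ ls i := by
  have h : ∀ c, Measurable fun ω => if i < n then powDist (y ω) z i c else 0 := by
    intro c
    split_ifs
    · exact measurable_powDist hy z i c
    · exact measurable_const
  induction ls with
  | nil => exact h c₁
  | cons l ls ih => exact ih.min (h l)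

lemma measurable_sum_ofFun {a : Ω → ℕ → ℝ} (ha : ∀ i, Measurable fun ω => a ω i) (q off : ℕ) :
    Measurable fun ω => (SumTree.ofFun (a ω) q off).sum := by
  simp only [SumTree.sum_ofFun]
  exact Finset.measurable_sum _ fun i _ => ha i

lemma discreteMeasurable_find {a : Ω → ℕ → ℝ} (ha : ∀ i, Measurable fun ω => a ω i)
    {r : Ω → ℝ} (hr : Measurable r) (q off off' h : ℕ) :
    DiscreteMeasurable fun ω => (SumTree.ofFun (a ω) q off).find (r ω) off' h := by
  induction q generalizing off off' r h with
  | zero => exact DiscreteMeasurable.const _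
  | succ q ih =>
    have hs := measurable_sum_ofFun ha q off
    simp only [SumTree.ofFun, SumTree.find]
    refine (DiscreteMeasurable.const tick).bind fun _ => ?_
    refine DiscreteMeasurable.op_bind (DiscreteMeasurable.op_bind (DiscreteMeasurable.op_bind ?_))
    refine DiscreteMeasurable.ite ?_ (ih hr off _ _)
      (DiscreteMeasurable.op_bind (DiscreteMeasurable.op_bind (ih (hr.sub hs) _ _ _)))
    simpa using measurableSet_lt hr hs

lemma discreteMeasurable_pick {a : Ω → ℕ → ℝ} (ha : ∀ i, Measurable fun ω => a ω i)
    {u : Ω → ℝ} (hu : Measurable u) (n q : ℕ) :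
    DiscreteMeasurable fun ω => pick n q (a ω) (u ω) := by
  have hs := measurable_sum_ofFun ha q 0
  refine (DiscreteMeasurable.const tick).bind fun _ => ?_
  refine DiscreteMeasurable.op_bind (DiscreteMeasurable.op_bind ?_)
  refine DiscreteMeasurable.ite ?_
    (DiscreteMeasurable.op_bind (discreteMeasurable_find ha (hu.mul hs) q 0 0 _))
    (DiscreteMeasurable.of_measurable (Nat.measurable_floor.comp (hu.mul_const (n : ℝ)))).op
  simpa using measurableSet_lt measurable_const hs

lemma discreteMeasurable_leftEnd {P : Ω → ℕ → Bool} (hP : ∀ i, DiscreteMeasurable fun ω => P ω i)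
    (m : ℕ) : DiscreteMeasurable fun ω => leftEnd (P ω) m := by
  induction m with
  | zero => exact DiscreteMeasurable.const _
  | succ m ih => exact DiscreteMeasurable.ite ((hP m).2 {true}) ih (DiscreteMeasurable.const _)

lemma discreteMeasurable_rightEnd {P : Ω → ℕ → Bool}
    (hP : ∀ i, DiscreteMeasurable fun ω => P ω i) (n f j : ℕ) :
    DiscreteMeasurable fun ω => rightEnd n (P ω) f j := by
  induction f generalizing j with
  | zero => exact DiscreteMeasurable.const _
  | succ f ih =>
    refine DiscreteMeasurable.ite (by measurability) ?_ (DiscreteMeasurable.const _)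
    exact DiscreteMeasurable.ite ((hP j).2 {true}) (ih _) (DiscreteMeasurable.const _)

lemma discreteMeasurable_roundCost {y : Ω → ℕ → ℝ} (hy : ∀ i, Measurable fun ω => y ω i)
    (n q : ℕ) (z : ℝ) (c₁ : ℕ) (ls : List ℕ) (l : ℕ) :
    DiscreteMeasurable fun ω => roundCost n q (y ω) z c₁ ls l := by
  have hc : ∀ i, DiscreteMeasurable fun ω => closer n (y ω) z c₁ ls l i := fun i =>
    DiscreteMeasurable.decide
      (measurableSet_lt (measurable_powDist hy z i l) (measurable_weight hy n z c₁ ls i))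
  exact (discreteMeasurable_leftEnd hc l).piecewise
    (F := fun lo ω => scanCost n q l lo (rightEnd n (closer n (y ω) z c₁ ls l) n (l + 1)))
    fun lo => (discreteMeasurable_rightEnd hc n n (l + 1)).map _

lemma discreteMeasurable_seedModel {y : Ω → ℕ → ℝ} (hy : ∀ i, Measurable fun ω => y ω i)
    (n q : ℕ) (z : ℝ) (c₁ m : ℕ) {u : Ω → Fin m → ℝ} (hu : ∀ t, Measurable fun ω => u ω t)
    (ls : List ℕ) :
    DiscreteMeasurable fun ω => seedModel n q (y ω) z c₁ m (u ω) ls := by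
  induction m generalizing ls with
  | zero => exact DiscreteMeasurable.const _
  | succ m ih =>
    refine (discreteMeasurable_pick (measurable_weight hy n z c₁ ls) (hu 0) n q).bind fun l => ?_
    refine DiscreteMeasurable.bind ?_ fun _ => ih (fun t => hu t.succ) (l :: ls)
    exact (discreteMeasurable_roundCost hy n q z c₁ ls l).map fun t => (⟨(), t⟩ : Timed Unit)

lemma discreteMeasurable_hits {y : ℕ → ℝ} (n q : ℕ) (z : ℝ) (c₁ i m : ℕ) {u : Ω → Fin m → ℝ}
    (hu : ∀ t, Measurable fun ω => u ω t) (ls : List ℕ) :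
    DiscreteMeasurable fun ω => hits n q y z c₁ i m (u ω) ls := by
  induction m generalizing ls with
  | zero => exact DiscreteMeasurable.const _
  | succ m ih =>
    refine DiscreteMeasurable.piecewise
      (p := fun ω => (pick n q (weight n y z c₁ ls) (u ω 0)).val)
      (F := fun l ω => (if powDist y z i l < weight n y z c₁ ls i then 1 else 0)
        + hits n q y z c₁ i m (Fin.tail (u ω)) (l :: ls)) ?_ fun l => ?_
    · exact (discreteMeasurable_pick (a := fun _ => weight n y z c₁ ls)
        (fun _ => measurable_const) (hu 0) n q).map Timed.val
    · exact (ih (u := fun ω => Fin.tail (u ω)) (fun t => hu t.succ) (l :: ls)).map _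

lemma discreteMeasurable_advance {y : Ω → ℕ → ℝ} (hy : ∀ i, Measurable fun ω => y ω i)
    (k : ℕ) (c : ℕ → ℕ) (i j : ℕ) : DiscreteMeasurable fun ω => advance k (y ω) c i j := by
  refine DiscreteMeasurable.op_bind (DiscreteMeasurable.op_bind ?_)
  refine DiscreteMeasurable.ite (by measurability) ?_ (DiscreteMeasurable.const _)
  refine (DiscreteMeasurable.const (rd c j)).bind fun c₀ =>
    (DiscreteMeasurable.const (rd c _)).bind fun c₁ => ?_
  refine DiscreteMeasurable.rd_bind (DiscreteMeasurable.rd_bind (DiscreteMeasurable.rd_bind ?_))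
  refine DiscreteMeasurable.op_bind (DiscreteMeasurable.op_bind (DiscreteMeasurable.op_bind
    (DiscreteMeasurable.op_bind (DiscreteMeasurable.op ?_))))
  exact DiscreteMeasurable.decide
    (measurableSet_le (((hy i).sub (hy c₁)).abs) (((hy i).sub (hy c₀)).abs))

lemma discreteMeasurable_assign {y : Ω → ℕ → ℝ} (hy : ∀ i, Measurable fun ω => y ω i)
    (n k : ℕ) (c ord : ℕ → ℕ) (f i j : ℕ) (σ : ℕ → ℕ) :
    DiscreteMeasurable fun ω => assign n k (y ω) c ord f i j σ := by
  induction f generalizing i j σ with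
  | zero => exact DiscreteMeasurable.const _
  | succ f ih =>
    refine DiscreteMeasurable.op_bind ?_
    refine DiscreteMeasurable.ite (by measurability) ?_ (DiscreteMeasurable.const _)
    refine (discreteMeasurable_advance hy k c i j).bind fun adv => ?_
    cases adv
    · exact (DiscreteMeasurable.const _).bind fun o => (DiscreteMeasurable.const _).bind fun σ =>
        (DiscreteMeasurable.const _).bind fun i => ih i j σ
    · exact (DiscreteMeasurable.const _).bind fun j => ih i j σ

end Measurability

/-! ### The running time of the algorithm -/

/-- The sorted points on the line, if `sorted` lists the indices in sorted order. -/
noncomputable def sortedPoints (n : ℕ) (x : ℕ → ℝ) (sorted : List ℕ) : ℕ → ℝ :=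
  fun i => if i < n then x ((fill sorted 0 fun _ => 0).val i) else 0

/-- The seeding procedure, with the seeding loop replaced by its model, and without the steps whose
cost does not depend on the random numbers. -/
noncomputable def seedingModel (n k q : ℕ) (z : ℝ) (x : ℕ → ℝ) (u₁ : ℝ) (u : Fin (k - 1) → ℝ) :
    Timed ((ℕ → ℕ) × (ℕ → ℕ)) := do
  let sorted ← mergeSort (keyLe x) n (indexList n []).val
  let l₁ ← drawIndex n u₁
  let ls ← seedModel n q (sortedPoints n x sorted) z l₁ (k - 1) u []
  let ls ← mergeSort idxLe k ls
  let σ ← assign n k (sortedPoints n x sorted) (fill ls 0 fun _ => 0).val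
    (fill sorted 0 fun _ => 0).val (n + k) 0 0 fun _ => 0
  pure ((relabel (fill ls 0 fun _ => 0).val (fill sorted 0 fun _ => 0).val k fun _ => 0).val, σ)

lemma discreteMeasurable_seedingModel {Ω : Type*} [MeasurableSpace Ω] {x : Ω → ℕ → ℝ}
    (hx : ∀ i, Measurable fun ω => x ω i) {u₁ : Ω → ℝ} (hu₁ : Measurable u₁) (n k q : ℕ) (z : ℝ)
    {u : Ω → Fin (k - 1) → ℝ} (hu : ∀ t, Measurable fun ω => u ω t) :
    DiscreteMeasurable fun ω => seedingModel n k q z (x ω) (u₁ ω) (u ω) := by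
  refine (discreteMeasurable_mergeSort (discreteMeasurable_keyLe hx) n _).bind fun sorted => ?_
  have hy : ∀ i, Measurable fun ω => sortedPoints n (x ω) sorted i := by
    intro i
    unfold sortedPoints
    split_ifs
    · exact hx _
    · exact measurable_const
  refine DiscreteMeasurable.bind
    (DiscreteMeasurable.of_measurable (Nat.measurable_floor.comp (hu₁.mul_const (n : ℝ)))).op
    fun l₁ => ?_
  refine (discreteMeasurable_seedModel hy n q z l₁ (k - 1) hu []).bind fun ls => ?_
  refine (DiscreteMeasurable.const _).bind fun ls' => ?_
  exact (discreteMeasurable_assign hy n k _ _ _ _ _ _).bind fun σ => DiscreteMeasurable.const _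

/-- The depth of the sampling tree for `n` points. -/
noncomputable def treeDepth (n : ℕ) : ℕ := (SumTree.depth n n 0 1).val.1

lemma treeDepth_spec {n : ℕ} (hn : 1 ≤ n) : n ≤ 2 ^ treeDepth n ∧ 2 ^ treeDepth n ≤ 2 * n := by
  obtain ⟨-, h2, h3, -⟩ := SumTree.depth_spec n n 0 (by rw [zero_add]; exact n.lt_two_pow_self.le)
  refine ⟨h2, h3.trans (max_le ?_ le_rfl)⟩
  rw [pow_zero]; omega

lemma sortedPoints_mono {n : ℕ} {x : ℕ → ℝ} (i j : ℕ) (hij : i ≤ j) (hj : j < n) :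
    sortedPoints n x (mergeSort (keyLe x) n (indexList n []).val).val i
      ≤ sortedPoints n x (mergeSort (keyLe x) n (indexList n []).val).val j := by
  have hlen : (mergeSort (keyLe x) n (indexList n []).val).val.length = n := by
    simp [mergeSort_length, indexList_spec]
  have hs := mergeSort_sorted (x := x) n (indexList n []).val (by simp [indexList_spec])
  generalize (mergeSort (keyLe x) n (indexList n []).val).val = s at *
  rcases eq_or_lt_of_le hij with rfl | h
  · exact le_rfl
  · simp only [sortedPoints, fill_val, hj, h.trans hj, if_true, hlen, Nat.zero_le, true_and,
      Nat.sub_zero, dif_pos]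
    exact List.pairwise_iff_getElem.1 hs i j (by omega) (by omega) h

/-- The cost of the steps of the seeding procedure that are not part of `seedingModel`. -/
noncomputable def seedingOverhead (n k : ℕ) : ℕ :=
  20 * n + 9 * k + 12 + (SumTree.depth n n 0 1).time
    + (SumTree.build n (fun _ => 0) (treeDepth n) 0 (2 ^ treeDepth n)).time

lemma SumTree.build_time_congr (n : ℕ) (a b : ℕ → ℝ) (q off h : ℕ) :
    (SumTree.build n a q off h).time = (SumTree.build n b q off h).time := by
  induction q generalizing off h with
  | zero => by_cases h : off < n <;> simp [SumTree.build, h]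
  | succ q ih =>
    simp only [SumTree.build, bind_time, ih _ (h / 2), op_val]
    simp

lemma fill_time_of_length {l : List ℕ} {m : ℕ} (h : l.length = m) (i : ℕ) (A : ℕ → ℕ) :
    (fill l i A).time = 3 * m + 1 := by rw [fill_time, h]

lemma seeding_eq {n k : ℕ} {z : ℝ} (hz : 1 ≤ z) (hk : 1 ≤ k) (hn : 1 ≤ n) (x : ℕ → ℝ) (u₁ : ℝ)
    (u : Fin (k - 1) → ℝ) (hu : ∀ t, u t ∈ Set.Ico (0 : ℝ) 1) :
    (seeding n k z x u₁ u).val = (seedingModel n k (treeDepth n) z x u₁ u).val ∧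
    (seeding n k z x u₁ u).time
      = (seedingModel n k (treeDepth n) z x u₁ u).time + seedingOverhead n k := by
  have hlen : (mergeSort (keyLe x) n (indexList n []).val).val.length = n := by
    simp [mergeSort_length, indexList_spec]
  have hmono := sortedPoints_mono (n := n) (x := x)
  have hd := (SumTree.depth_spec n n 0
    (by rw [zero_add]; exact n.lt_two_pow_self.le)).1
  rw [pow_zero] at hd
  have hdepth : (SumTree.depth n n 0 1).val = (treeDepth n, 2 ^ treeDepth n) := Prod.ext rfl hd
  generalize hs : mergeSort (keyLe x) n (indexList n []).val = s at *
  have hy : ∀ l₁, (initDist (sortedPoints n x s.val) z l₁ n fun _ => 0).val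
      = weight n (sortedPoints n x s.val) z l₁ [] := by
    intro l₁
    rw [(initDist_spec _ _ _ _ _).2]
    rfl
  have hb := SumTree.build_spec n (weight n (sortedPoints n x s.val) z (drawIndex n u₁).val [])
    (fun i hi => weight_of_le hi) (treeDepth n) 0
  have hloop := seedLoop_eq (c₁ := (drawIndex n u₁).val) hz hmono hn (treeDepth_spec hn).1 (k - 1)
    u hu []
  rw [List.nil_append] at hloop
  have hlen' := seedModel_length (n := n) (q := treeDepth n) (y := sortedPoints n x s.val) (z := z)
    (c₁ := (drawIndex n u₁).val) (k - 1) u []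
  constructor
  · simp only [seeding, seedingModel, bind_val, pure_val, alloc_val, hs, hdepth,
      (gather_spec _ _ _ _).2]
    rw [show (fun i => if i < n then x ((fill s.val 0 fun _ => 0).val i) else 0)
      = sortedPoints n x s.val from rfl, hy, hb.1, hloop]
  · simp only [seeding, seedingModel, bind_time, pure_time, alloc_val, alloc_time, hs,
      hdepth, (gather_spec _ _ _ _).2, (gather_spec _ _ _ _).1, (indexList_spec _ _).1,
      (initDist_spec _ _ _ _ _).1, relabel_time]
    rw [show (fun i => if i < n then x ((fill s.val 0 fun _ => 0).val i) else 0)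
      = sortedPoints n x s.val from rfl, hy, hb.1, hloop]
    rw [fill_time_of_length hlen, fill_time_of_length (m := k) (by
      rw [mergeSort_length, hlen', List.length_nil]; omega)]
    rw [SumTree.build_time_congr n _ (fun _ => 0), seedingOverhead]
    ring

/-- The cost of the computation of the centers of mass. -/
noncomputable def centroidCost {d : ℕ} (rows : ℕ → SparseVec d) (n k : ℕ)
    (r : (ℕ → ℕ) × (ℕ → ℕ)) : ℕ :=
  (k + 1) + (bucket r.2 n fun _ => []).time + (d + 1) + (k + 1)
    + (centroids rows (bucket r.2 n fun _ => []).val r.1 k (fun _ => 0) fun _ => []).time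

/-- The projections of the points. -/
noncomputable def projections {d : ℕ} (rows : ℕ → SparseVec d) (n : ℕ) (v : Fin d → ℝ) : ℕ → ℝ :=
  (project rows v n fun _ => 0).val

lemma measurable_dot {d : ℕ} (row : SparseVec d) {f : (Fin d → ℝ) → ℝ} (hf : Measurable f) :
    Measurable fun v => (dot v row (f v)).val := by
  induction row generalizing f with
  | nil => exact hf
  | cons p row ih =>
    obtain ⟨j, x⟩ := p
    exact ih (f := fun v => f v + x * v j) (by fun_prop)

lemma measurable_projections {d : ℕ} (rows : ℕ → SparseVec d) (n i : ℕ) :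
    Measurable fun v => projections rows n v i := by
  have : ∀ (m : ℕ) (x : (Fin d → ℝ) → ℕ → ℝ), (∀ i, Measurable fun v => x v i) →
      ∀ i, Measurable fun v => (project rows v m (x v)).val i := by
    intro m
    induction m with
    | zero => exact fun x hx => hx
    | succ m ih =>
      intro x hx
      refine ih (fun v => Function.update (x v) m (dot v (rows m) 0).val) fun i => ?_
      by_cases h : i = m
      · subst h; simpa using measurable_dot (rows i) measurable_const
      · simpa [h] using hx i
  exact this n _ (fun _ => measurable_const) i

section RunTime

variable {d n k : ℕ} {z : ℝ}

/-- The part of the running time that does not depend on the random numbers. -/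
noncomputable def overhead (X : Fin n → EuclideanSpace ℝ (Fin d)) (k : ℕ) : ℕ :=
  (2 * d + 1) + (n + 1) + (4 * n + 1 + 4 * nnz X) + seedingOverhead n k

/-- The running time, computed from the model of the seeding procedure. -/
noncomputable def runTimeModel (X : Fin n → EuclideanSpace ℝ (Fin d)) (k : ℕ) (z : ℝ)
    (ω : Tape d k) : ℕ :=
  overhead X k
    + (seedingModel n k (treeDepth n) z (projections (sparseRows X) n ω.1) ω.2.1 ω.2.2).time
    + centroidCost (sparseRows X) n k
      (seedingModel n k (treeDepth n) z (projections (sparseRows X) n ω.1) ω.2.1 ω.2.2).val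

lemma runTime_eq_model (X : Fin n → EuclideanSpace ℝ (Fin d)) (hz : 1 ≤ z) (hk : 1 ≤ k)
    (hn : 1 ≤ n) {ω : Tape d k} (hω : IsTape ω) : runTime X k z ω = runTimeModel X k z ω := by
  obtain ⟨h1, h2⟩ := seeding_eq hz hk hn (projections (sparseRows X) n ω.1) ω.2.1 ω.2.2 hω.2
  rw [runTimeModel, ← h1]
  have h3 := project_time (sparseRows X) ω.1 n fun _ => 0
  rw [sum_sparseRows_length] at h3
  simp only [runTime, prone, bind_time, alloc_val, alloc_time, pure_time]
  rw [show (drawVector ω.1).val = ω.1 from rfl, show (drawVector ω.1).time = 2 * d + 1 from rfl,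
    h3, show (project (sparseRows X) ω.1 n fun _ => 0).val = projections (sparseRows X) n ω.1
    from rfl, h2, centroidCost, overhead]
  ring

lemma discreteMeasurable_runTimeModel (X : Fin n → EuclideanSpace ℝ (Fin d)) :
    DiscreteMeasurable fun ω : Tape d k => runTimeModel X k z ω := by
  have h := discreteMeasurable_seedingModel (Ω := Tape d k)
    (x := fun ω => projections (sparseRows X) n ω.1)
    (fun i => (measurable_projections (sparseRows X) n i).comp measurable_fst)
    (u₁ := fun ω => ω.2.1) (measurable_fst.comp measurable_snd) n k (treeDepth n) z
    (u := fun ω => ω.2.2)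
    (fun t => (measurable_pi_apply t).comp (measurable_snd.comp measurable_snd))
  exact h.map fun r => overhead X k + r.time + centroidCost (sparseRows X) n k r.val

lemma centroidCost_le (X : Fin n → EuclideanSpace ℝ (Fin d)) (r : (ℕ → ℕ) × (ℕ → ℕ)) :
    centroidCost (sparseRows X) n k r ≤ 12 * nnz X + 9 * n + 8 * k + d + 5 := by
  have h1 := centroids_time (sparseRows X) (bucket r.2 n fun _ => []).val r.1 k
    (fun _ : Fin d => (0 : ℝ)) (fun _ => [])
  have h2 := bucket_sum r.2 (fun i => 12 * (sparseRows X i).length + 4) k n fun _ => []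
  rw [Finset.sum_add_distrib, ← Finset.mul_sum, sum_sparseRows_length] at h2
  simp only [List.map_nil, List.sum_nil, Finset.sum_const_zero, zero_add, Finset.sum_const,
    Finset.card_range, smul_eq_mul] at h2
  rw [centroidCost, bucket_time]
  omega

lemma overhead_le (X : Fin n → EuclideanSpace ℝ (Fin d)) (hn : 1 ≤ n) (hk : k ≤ n)
    (hd : d ≤ nnz X) :
    overhead X k ≤ 6 * nnz X + 70 * n * (treeDepth n + 1) := by
  have h1 := (SumTree.build_spec n (fun _ => 0) (fun _ _ => rfl) (treeDepth n) 0).2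
  have h2 := (SumTree.depth_spec n n 0 (by rw [zero_add]; exact n.lt_two_pow_self.le)).2.2.2
  rw [pow_zero] at h2
  change _ ≤ 3 * treeDepth n + 1 at h2
  have h3 := treeDepth_spec hn
  rw [overhead, seedingOverhead]
  have : treeDepth n ≤ n * treeDepth n := Nat.le_mul_of_pos_left _ hn
  have e : 70 * n * (treeDepth n + 1) = 70 * (n * treeDepth n) + 70 * n := by ring
  rw [e]
  omega

/-- Apart from the seeding loop, the algorithm takes time `O(nnz X + n log n)`. -/
lemma exists_runTimeModel_le (X : Fin n → EuclideanSpace ℝ (Fin d)) (hn : 1 ≤ n) (hk : 1 ≤ k)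
    (hkn : k ≤ n) (hd : d ≤ nnz X) (v : Fin d → ℝ) (u₁ : ℝ) :
    ∃ (y : ℕ → ℝ) (c₁ : ℕ), (∀ i j, i ≤ j → j < n → y i ≤ y j) ∧ ∀ u, runTimeModel X k z (v, u₁, u)
      ≤ 19 * nnz X + 150 * (n * (treeDepth n + 1))
        + (seedModel n (treeDepth n) y z c₁ (k - 1) u []).time := by
  set x := projections (sparseRows X) n v with hx
  set s := mergeSort (keyLe x) n (indexList n []).val with hs
  refine ⟨sortedPoints n x s.val, (drawIndex n u₁).val, sortedPoints_mono, fun u => ?_⟩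
  have hq := treeDepth_spec hn
  have h1 : s.time ≤ 10 * n * treeDepth n + 1 := by
    have := mergeSort_time (keyLe_time x) n (indexList n []).val (treeDepth n)
      (by simpa [indexList_spec] using hq.1)
    simpa [indexList_spec] using this
  set p := seedModel n (treeDepth n) (sortedPoints n x s.val) z (drawIndex n u₁).val (k - 1) u []
    with hp
  have hlen : p.val.length = k := by
    rw [hp, seedModel_length, List.length_nil]; omega
  have h2 : (mergeSort idxLe k p.val).time ≤ 10 * k * treeDepth n + 1 := by
    have := mergeSort_time idxLe_time k p.val (treeDepth n) (by rw [hlen]; omega)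
    rwa [hlen] at this
  have h3 := assign_time n k (sortedPoints n x s.val)
    (fill (mergeSort idxLe k p.val).val 0 fun _ => 0).val (fill s.val 0 fun _ => 0).val (n + k) 0 0
    fun _ => 0
  have h4 := overhead_le X hn hkn hd
  have h5 := centroidCost_le (k := k) X (seedingModel n k (treeDepth n) z x u₁ u).val
  have h6 : (seedingModel n k (treeDepth n) z x u₁ u).time
      ≤ s.time + 1 + p.time + (10 * k * treeDepth n + 1) + 16 * (n + k) := by
    simp only [seedingModel, bind_time, pure_time, ← hs, ← hp]
    have : (drawIndex n u₁).time = 1 := rfl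
    omega
  have h7 : k * treeDepth n ≤ n * treeDepth n := Nat.mul_le_mul_right _ hkn
  have e1 : 70 * n * (treeDepth n + 1) = 70 * (n * treeDepth n) + 70 * n := by ring
  have e2 : 150 * (n * (treeDepth n + 1)) = 150 * (n * treeDepth n) + 150 * n := by ring
  have e3 : 10 * k * treeDepth n = 10 * (k * treeDepth n) := by ring
  have e4 : 10 * n * treeDepth n = 10 * (n * treeDepth n) := by ring
  change overhead X k + (seedingModel n k (treeDepth n) z x u₁ u).time
    + centroidCost (sparseRows X) n k (seedingModel n k (treeDepth n) z x u₁ u).val ≤ _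
  omega

end RunTime

/-! ### Random elements of a set with controlled weights -/

section Rank

variable {ι : Type*}

/-- In a set `R` with weights `a` and keys `D`, suppose that the weight of an element is at most
`s ^ 2` times the weight of each element with a smaller key. Then a random element of `R`, drawn
with probability proportional to `a`, has at least `|R| / (4 * s)` elements above or level with it,
on average.

Write `b j` for the number of elements level with `j` or above, and `X` for the weighted sum of
`b`. An element `f` with `b f ≤ |R| / 2` has weight at most `4 * s ^ 2 * X / |R| ^ 2`, since the
elements below `f` contribute to `X`. There are at most `t` elements with `b f ≤ t`, and the others
have total weight at most `X / t`. The two contributions are balanced for `t = |R| / (2 * s)`. -/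
lemma card_mul_sum_le (R : Finset ι) (a D : ι → ℝ) (s : ℝ) (hs : 1 ≤ s) (ha : ∀ j ∈ R, 0 ≤ a j)
    (h : ∀ j ∈ R, ∀ j' ∈ R, D j' < D j → a j ≤ s ^ 2 * a j') :
    (R.card : ℝ) * ∑ j ∈ R, a j
      ≤ 4 * s * ∑ j ∈ R, a j * ((R.filter fun j' => D j ≤ D j').card : ℝ) := by
  classical
  rcases R.eq_empty_or_nonempty with rfl | hR
  · simp
  set b : ι → ℝ := fun j => ((R.filter fun j' => D j ≤ D j').card : ℝ) with hb
  set m : ℝ := (R.card : ℝ) with hm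
  set X : ℝ := ∑ j ∈ R, a j * b j with hX
  have hm0 : 0 < m := by rw [hm]; exact_mod_cast hR.card_pos
  have hb0 : ∀ j, 0 ≤ b j := fun j => Nat.cast_nonneg _
  have hbmono : ∀ f j, D f ≤ D j → b j ≤ b f := by
    intro f j hfj
    simp only [hb]
    gcongr
  -- each pair is counted in one of its two orders
  have hpairs : m ^ 2 ≤ 2 * ∑ j ∈ R, b j := by
    have e1 : ∑ j ∈ R, b j = ∑ j ∈ R, ∑ j' ∈ R, if D j ≤ D j' then (1 : ℝ) else 0 := by
      simp [hb]
    have e2 : ∑ j ∈ R, b j = ∑ j ∈ R, ∑ j' ∈ R, if D j' ≤ D j then (1 : ℝ) else 0 := by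
      rw [e1, Finset.sum_comm]
    have e3 : m ^ 2 = ∑ j ∈ R, ∑ j' ∈ R, (1 : ℝ) := by simp [hm, sq]
    rw [two_mul]
    nth_rw 1 [e1]
    rw [e2, e3, ← Finset.sum_add_distrib]
    refine Finset.sum_le_sum fun j _ => ?_
    rw [← Finset.sum_add_distrib]
    refine Finset.sum_le_sum fun j' _ => ?_
    rcases le_total (D j) (D j') with h | h <;> simp only [h, if_true] <;> split_ifs <;> norm_num
  have hX0 : 0 ≤ X := Finset.sum_nonneg fun j hj => mul_nonneg (ha j hj) (hb0 j)
  have hfar : ∀ f ∈ R, b f ≤ m / 2 → a f * m ^ 2 ≤ 4 * s ^ 2 * X := by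
    intro f hf hbf
    have e1 : ∑ j ∈ R.filter (fun j => D f ≤ D j), b j ≤ m ^ 2 / 4 := by
      calc ∑ j ∈ R.filter (fun j => D f ≤ D j), b j
          ≤ ∑ j ∈ R.filter (fun j => D f ≤ D j), b f :=
            Finset.sum_le_sum fun j hj => hbmono f j (Finset.mem_filter.1 hj).2
        _ = b f * b f := by rw [Finset.sum_const, nsmul_eq_mul]
        _ ≤ m ^ 2 / 4 := by nlinarith [hb0 f]
    have e2 := Finset.sum_filter_add_sum_filter_not R (fun j => D f ≤ D j) b
    have e3 : a f * ∑ j ∈ R.filter (fun j => ¬ D f ≤ D j), b j ≤ s ^ 2 * X := by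
      rw [hX, Finset.mul_sum, Finset.mul_sum]
      calc ∑ j ∈ R.filter (fun j => ¬ D f ≤ D j), a f * b j
          ≤ ∑ j ∈ R.filter (fun j => ¬ D f ≤ D j), s ^ 2 * (a j * b j) := by
            refine Finset.sum_le_sum fun j hj => ?_
            obtain ⟨hj, hj'⟩ := Finset.mem_filter.1 hj
            rw [← mul_assoc]
            exact mul_le_mul_of_nonneg_right (h f hf j hj (not_le.1 hj')) (hb0 j)
        _ ≤ ∑ j ∈ R, s ^ 2 * (a j * b j) :=
            Finset.sum_le_sum_of_subset_of_nonneg (Finset.filter_subset _ _)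
              fun j hj _ => mul_nonneg (sq_nonneg _) (mul_nonneg (ha j hj) (hb0 j))
    have e4 : m ^ 2 / 4 ≤ ∑ j ∈ R.filter (fun j => ¬ D f ≤ D j), b j := by linarith
    nlinarith [mul_le_mul_of_nonneg_left e4 (ha f hf)]
  set t : ℝ := m / (2 * s) with ht
  have ht0 : 0 < t := by positivity
  have htm : t ≤ m / 2 := by
    rw [ht]; gcongr; linarith
  have hcard : ((R.filter fun f => b f ≤ t).card : ℝ) ≤ t := by
    rcases (R.filter fun f => b f ≤ t).eq_empty_or_nonempty with he | hne
    · rw [he]; simpa using ht0.le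
    · obtain ⟨f, hf, hmin⟩ := Finset.exists_min_image _ D hne
      refine le_trans ?_ (Finset.mem_filter.1 hf).2
      simp only [hb]
      refine Nat.cast_le.2 (Finset.card_le_card fun j hj => ?_)
      exact Finset.mem_filter.2 ⟨(Finset.mem_filter.1 hj).1, hmin j hj⟩
  have hlow : (∑ f ∈ R.filter (fun f => b f ≤ t), a f) * m ≤ 2 * s * X := by
    have e1 : (∑ f ∈ R.filter (fun f => b f ≤ t), a f) * m ^ 2 ≤ t * (4 * s ^ 2 * X) := by
      rw [Finset.sum_mul]
      calc ∑ f ∈ R.filter (fun f => b f ≤ t), a f * m ^ 2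
          ≤ ∑ f ∈ R.filter (fun f => b f ≤ t), 4 * s ^ 2 * X :=
            Finset.sum_le_sum fun f hf =>
              hfar f (Finset.mem_filter.1 hf).1 ((Finset.mem_filter.1 hf).2.trans htm)
        _ ≤ t * (4 * s ^ 2 * X) := by
            rw [Finset.sum_const, nsmul_eq_mul]
            gcongr
    have e2 : t * (4 * s ^ 2 * X) = (2 * s * X) * m := by rw [ht]; field_simp; ring
    rw [e2, sq, ← mul_assoc] at e1
    exact le_of_mul_le_mul_right e1 hm0
  have hhigh : (∑ f ∈ R.filter (fun f => ¬ b f ≤ t), a f) * m ≤ 2 * s * X := by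
    have e1 : (∑ f ∈ R.filter (fun f => ¬ b f ≤ t), a f) * t ≤ X := by
      rw [Finset.sum_mul]
      calc ∑ f ∈ R.filter (fun f => ¬ b f ≤ t), a f * t
          ≤ ∑ f ∈ R.filter (fun f => ¬ b f ≤ t), a f * b f := by
            refine Finset.sum_le_sum fun f hf => ?_
            obtain ⟨hf, hf'⟩ := Finset.mem_filter.1 hf
            exact mul_le_mul_of_nonneg_left (not_le.1 hf').le (ha f hf)
        _ ≤ X := Finset.sum_le_sum_of_subset_of_nonneg (Finset.filter_subset _ _)
              fun j hj _ => mul_nonneg (ha j hj) (hb0 j)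
    have e2 : m = 2 * s * t := by rw [ht]; field_simp
    rw [e2]
    nlinarith
  have := Finset.sum_filter_add_sum_filter_not R (fun f => b f ≤ t) a
  rw [← this]
  linarith

/-- Under the assumptions of `card_mul_sum_le`, the number of elements below a random element is
smaller than `|R|` by a constant factor, on average. -/
lemma sum_mul_card_lt_le (R : Finset ι) (a D : ι → ℝ) (s : ℝ) (hs : 1 ≤ s)
    (ha : ∀ j ∈ R, 0 ≤ a j) (h : ∀ j ∈ R, ∀ j' ∈ R, D j' < D j → a j ≤ s ^ 2 * a j') :
    ∑ j ∈ R, a j * ((R.filter fun j' => D j' < D j).card + 1 : ℝ)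
      ≤ (1 - 1 / (8 * s)) * (R.card + 1) * ∑ j ∈ R, a j := by
  rcases R.eq_empty_or_nonempty with rfl | hR
  · simp
  have hm : (1 : ℝ) ≤ R.card := by exact_mod_cast hR.card_pos
  have key := card_mul_sum_le R a D s hs ha h
  have e : ∀ j ∈ R, a j * ((R.filter fun j' => D j' < D j).card + 1 : ℝ)
      = (R.card + 1) * a j - a j * ((R.filter fun j' => D j ≤ D j').card : ℝ) := by
    intro j _
    have e1 := Finset.card_filter_add_card_filter_not (s := R) fun j' => D j' < D j
    simp only [not_lt] at e1
    have e2 : ((R.filter fun j' => D j' < D j).card : ℝ)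
        + ((R.filter fun j' => D j ≤ D j').card : ℝ) = R.card := by exact_mod_cast e1
    rw [← e2]; ring
  rw [Finset.sum_congr rfl e, Finset.sum_sub_distrib, ← Finset.mul_sum]
  set W := ∑ j ∈ R, a j
  set X := ∑ j ∈ R, a j * ((R.filter fun j' => D j ≤ D j').card : ℝ)
  have hW : 0 ≤ W := Finset.sum_nonneg ha
  have e3 : (R.card + 1) * W / (8 * s) ≤ X := by
    rw [div_le_iff₀ (by positivity)]
    nlinarith
  have e4 : (1 - 1 / (8 * s)) * (R.card + 1) * W = (R.card + 1) * W - (R.card + 1) * W / (8 * s) := by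
    ring
  rw [e4]
  linarith

end Rank

/-! ### The potential of a point -/

/-- The potential of the point `i` when its weight is `w`: the product of the numbers of points
before `i`, and from `i` on, that would decrease its weight if chosen (each number plus `1`). -/
noncomputable def potential (n : ℕ) (y : ℕ → ℝ) (z : ℝ) (i : ℕ) (w : ℝ) : ℝ :=
  (((Finset.range i).filter fun j => powDist y z i j < w).card + 1) *
    (((Finset.Ico i n).filter fun j => powDist y z i j < w).card + 1)

section Potential

variable {n : ℕ} {y : ℕ → ℝ} {z : ℝ} {c₁ : ℕ} {ls : List ℕ}

lemma potential_nonneg (i : ℕ) (w : ℝ) : 0 ≤ potential n y z i w := by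
  unfold potential; positivity

lemma potential_le {i : ℕ} (hi : i < n) (w : ℝ) : potential n y z i w ≤ ((n : ℝ) + 1) ^ 2 := by
  have h1 : ((Finset.range i).filter fun j => powDist y z i j < w).card ≤ n :=
    (Finset.card_filter_le _ _).trans (by simp; omega)
  have h2 : ((Finset.Ico i n).filter fun j => powDist y z i j < w).card ≤ n :=
    (Finset.card_filter_le _ _).trans (by simp)
  rw [sq]
  unfold potential
  gcongr

/-- If `j'` lies between `i` and `j`, and all centers are farther from `i` than `j` is, then the
distance of `j` to its closest center is at most twice the distance of `j'` to its closest
center. -/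
lemma weight_le_two_rpow_mul (hz : 1 ≤ z) {i j j' : ℕ} (hi : i < n) (hj : j < n) (hj' : j' < n)
    (hw : powDist y z i j < weight n y z c₁ ls i)
    (hb : y i ≤ y j' ∧ y j' ≤ y j ∨ y j ≤ y j' ∧ y j' ≤ y i) :
    weight n y z c₁ ls j ≤ 2 ^ z * weight n y z c₁ ls j' := by
  obtain ⟨c, hc, e⟩ := exists_weight_eq (y := y) (z := z) (c₁ := c₁) (ls := ls) hj'
  have h1 := (powDist_lt_iff hz).1 (hw.trans_le (weight_le hi hc))
  refine (weight_le hj hc).trans ?_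
  rw [e]
  unfold powDist
  rw [← Real.mul_rpow (by norm_num) (abs_nonneg _)]
  refine Real.rpow_le_rpow (abs_nonneg _) ?_ (by linarith)
  rcases hb with ⟨b1, b2⟩ | ⟨b1, b2⟩
  · rw [abs_of_nonpos (by linarith : y i - y j ≤ 0)] at h1
    rcases le_total (y i) (y c) with h2 | h2
    · rw [abs_of_nonpos (by linarith)] at h1
      rw [abs_of_nonpos (by linarith), abs_of_nonpos (by linarith)]
      linarith
    · rw [abs_of_nonneg (by linarith)] at h1
      rw [abs_of_nonneg (by linarith), abs_of_nonneg (by linarith)]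
      linarith
  · rw [abs_of_nonneg (by linarith : 0 ≤ y i - y j)] at h1
    rcases le_total (y i) (y c) with h2 | h2
    · rw [abs_of_nonpos (by linarith)] at h1
      rw [abs_of_nonpos (by linarith), abs_of_nonpos (by linarith)]
      linarith
    · rw [abs_of_nonneg (by linarith)] at h1
      rw [abs_of_nonneg (by linarith), abs_of_nonneg (by linarith)]
      linarith

/-- The points on one side `A` of `i`, those that decrease the weight of `i` if chosen: on average
over the choice, their number decreases by a constant factor. -/
lemma sum_side_le (hz : 1 ≤ z) {i : ℕ} (hi : i < n) (A : Finset ℕ) (hA : ∀ j ∈ A, j < n)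
    (hb : ∀ j ∈ A, ∀ j' ∈ A, |y i - y j'| < |y i - y j| →
      y i ≤ y j' ∧ y j' ≤ y j ∨ y j ≤ y j' ∧ y j' ≤ y i) :
    ∑ j ∈ A.filter (fun j => powDist y z i j < weight n y z c₁ ls i), weight n y z c₁ ls j *
        ((A.filter fun j' => powDist y z i j' < powDist y z i j).card + 1 : ℝ)
      ≤ (1 - 1 / (8 * 2 ^ (z / 2))) *
        ((A.filter fun j => powDist y z i j < weight n y z c₁ ls i).card + 1) *
        ∑ j ∈ A.filter (fun j => powDist y z i j < weight n y z c₁ ls i), weight n y z c₁ ls j := by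
  set R := A.filter fun j => powDist y z i j < weight n y z c₁ ls i with hR
  have hs : (1 : ℝ) ≤ 2 ^ (z / 2) := Real.one_le_rpow (by norm_num) (by linarith)
  have hs2 : ((2 : ℝ) ^ (z / 2)) ^ 2 = 2 ^ z := by
    rw [← Real.rpow_natCast, ← Real.rpow_mul (by norm_num)]; norm_num
  have key := sum_mul_card_lt_le R (weight n y z c₁ ls) (powDist y z i) _ hs
    (fun j _ => weight_nonneg j) (fun j hj j' hj' hlt => by
      rw [hs2]
      simp only [hR, Finset.mem_filter] at hj hj'
      exact weight_le_two_rpow_mul hz hi (hA j hj.1) (hA j' hj'.1) hj.2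
        (hb j hj.1 j' hj'.1 ((powDist_lt_iff hz).1 hlt)))
  refine le_trans (Finset.sum_le_sum fun j hj => ?_) key
  refine mul_le_mul_of_nonneg_left ?_ (weight_nonneg j)
  gcongr ?_ + 1
  rw [hR, Finset.filter_filter]
  gcongr with j' hj'
  intro h
  exact ⟨h.trans (Finset.mem_filter.1 hj).2, h⟩

/-- The rate at which the number of decreases of a weight is charged to the potential. -/
noncomputable def rate (z : ℝ) : ℝ := 1 / (8 * 2 ^ (z / 2))

lemma rate_pos (z : ℝ) : 0 < rate z := by unfold rate; positivity

lemma exp_rate_mul_le (z : ℝ) : Real.exp (rate z) * (1 - rate z) ≤ 1 := by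
  have h := Real.add_one_le_exp (-rate z)
  calc Real.exp (rate z) * (1 - rate z) ≤ Real.exp (rate z) * Real.exp (-rate z) := by
        gcongr; linarith
    _ = 1 := by rw [← Real.exp_add]; simp

/-- The potential of `i` after the choice of `j`, with a factor `exp (rate z)` if this decreases the
weight of `i`. -/
noncomputable def nextPotential (n : ℕ) (y : ℕ → ℝ) (z : ℝ) (c₁ : ℕ) (ls : List ℕ) (i j : ℕ) : ℝ :=
  (if powDist y z i j < weight n y z c₁ ls i then Real.exp (rate z) else 1) *
    potential n y z i (weight n y z c₁ (j :: ls) i)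

lemma nextPotential_of_not_lt {i j : ℕ} (hi : i < n)
    (h : ¬ powDist y z i j < weight n y z c₁ ls i) :
    nextPotential n y z c₁ ls i j = potential n y z i (weight n y z c₁ ls i) := by
  rw [nextPotential, if_neg h, one_mul, weight, if_pos hi, min_eq_left (not_lt.1 h)]

lemma nextPotential_of_lt {i j : ℕ} (hi : i < n) (h : powDist y z i j < weight n y z c₁ ls i) :
    nextPotential n y z c₁ ls i j = Real.exp (rate z) * potential n y z i (powDist y z i j) := by
  rw [nextPotential, if_pos h, weight, if_pos hi, min_eq_right h.le]

/-- In expectation over the next center, the potential pays for the decrease of the weight. -/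
lemma sum_weight_mul_nextPotential_le (hz : 1 ≤ z) (hy : ∀ i j, i ≤ j → j < n → y i ≤ y j) {i : ℕ}
    (hi : i < n) :
    ∑ j ∈ Finset.range n, weight n y z c₁ ls j * nextPotential n y z c₁ ls i j
      ≤ (∑ j ∈ Finset.range n, weight n y z c₁ ls j) *
        potential n y z i (weight n y z c₁ ls i) := by
  set w := weight n y z c₁ ls i with hw
  set a := weight n y z c₁ ls with ha
  have hside : ∀ A : Finset ℕ, (∀ j ∈ A, j < n) →
      (∀ j ∈ A, ∀ j' ∈ A, |y i - y j'| < |y i - y j| →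
        y i ≤ y j' ∧ y j' ≤ y j ∨ y j ≤ y j' ∧ y j' ≤ y i) → ∀ q : ℝ, 0 ≤ q →
      potential n y z i w = ((A.filter fun j => powDist y z i j < w).card + 1) * q →
      (∀ j, powDist y z i j < w → potential n y z i (powDist y z i j)
        ≤ ((A.filter fun j' => powDist y z i j' < powDist y z i j).card + 1) * q) →
      ∑ j ∈ A, a j * nextPotential n y z c₁ ls i j
        ≤ ∑ j ∈ A, a j * potential n y z i w := by
    intro A hA hb q hq e1 e2
    rw [← Finset.sum_filter_add_sum_filter_not A (fun j => powDist y z i j < w),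
      ← Finset.sum_filter_add_sum_filter_not A (fun j => powDist y z i j < w)
        (fun j => a j * potential n y z i w)]
    refine add_le_add ?_ (Finset.sum_le_sum fun j hj => ?_)
    · have key := sum_side_le (c₁ := c₁) (ls := ls) hz hi A hA hb
      rw [← ha, ← hw] at key
      calc ∑ j ∈ A.filter (fun j => powDist y z i j < w), a j * nextPotential n y z c₁ ls i j
          ≤ ∑ j ∈ A.filter (fun j => powDist y z i j < w), (Real.exp (rate z) * q) * (a j *
              ((A.filter fun j' => powDist y z i j' < powDist y z i j).card + 1 : ℝ)) := by
            refine Finset.sum_le_sum fun j hj => ?_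
            have hj := (Finset.mem_filter.1 hj).2
            rw [nextPotential_of_lt hi hj]
            calc a j * (Real.exp (rate z) * potential n y z i (powDist y z i j))
                ≤ a j * (Real.exp (rate z) * (((A.filter fun j' =>
                    powDist y z i j' < powDist y z i j).card + 1) * q)) := by
                  have := weight_nonneg (n := n) (y := y) (z := z) (c₁ := c₁) (ls := ls) j
                  gcongr
                  exact e2 j hj
              _ = _ := by ring
        _ ≤ (Real.exp (rate z) * q) * ((1 - rate z) *
              ((A.filter fun j => powDist y z i j < w).card + 1) *
              ∑ j ∈ A.filter (fun j => powDist y z i j < w), a j) := by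
            rw [← Finset.mul_sum]
            gcongr
            exact key
        _ = (Real.exp (rate z) * (1 - rate z)) * (potential n y z i w *
              ∑ j ∈ A.filter (fun j => powDist y z i j < w), a j) := by rw [e1]; ring
        _ ≤ 1 * (potential n y z i w * ∑ j ∈ A.filter (fun j => powDist y z i j < w), a j) := by
            refine mul_le_mul_of_nonneg_right (exp_rate_mul_le z) ?_
            exact mul_nonneg (potential_nonneg _ _)
              (Finset.sum_nonneg fun j _ => weight_nonneg j)
        _ = _ := by rw [one_mul, mul_comm, Finset.sum_mul]
    · rw [nextPotential_of_not_lt hi (Finset.mem_filter.1 hj).2]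
  rw [Finset.sum_mul, Finset.range_eq_Ico,
    ← Finset.sum_Ico_consecutive _ (Nat.zero_le i) hi.le,
    ← Finset.sum_Ico_consecutive _ (Nat.zero_le i) hi.le, ← Finset.range_eq_Ico]
  refine add_le_add ?_ ?_
  · refine hside _ (fun j hj => by simp at hj; omega) (fun j hj j' hj' hlt => Or.inr ?_)
      (((Finset.Ico i n).filter fun j => powDist y z i j < w).card + 1) (by positivity) rfl
      fun j hj => ?_
    · simp only [Finset.mem_range] at hj hj'
      have e1 := hy j i hj.le hi
      have e2 := hy j' i hj'.le hi
      rw [abs_of_nonneg (by linarith), abs_of_nonneg (by linarith)] at hlt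
      exact ⟨by linarith, e2⟩
    · unfold potential
      gcongr
  · refine hside _ (fun j hj => by simp at hj; omega) (fun j hj j' hj' hlt => Or.inl ?_)
      (((Finset.range i).filter fun j => powDist y z i j < w).card + 1) (by positivity)
      (mul_comm _ _) fun j hj => ?_
    · simp only [Finset.mem_Ico] at hj hj'
      have e1 := hy i j hj.1 hj.2
      have e2 := hy i j' hj'.1 hj'.2
      rw [abs_of_nonpos (by linarith), abs_of_nonpos (by linarith)] at hlt
      exact ⟨e2, by linarith⟩
    · unfold potential
      rw [mul_comm]
      gcongr

end Potential

/-! ### The expected exponential of the number of decreases -/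

instance : IsProbabilityMeasure uniform01 := ⟨by simp [uniform01]⟩

lemma ae_uniform01 : ∀ᵐ u ∂uniform01, u ∈ Set.Ico (0 : ℝ) 1 :=
  ae_restrict_mem measurableSet_Ico

lemma ae_pi_uniform01 (m : ℕ) :
    ∀ᵐ u ∂(Measure.pi fun _ : Fin m => uniform01), ∀ t, u t ∈ Set.Ico (0 : ℝ) 1 :=
  ae_all_iff.2 fun t =>
    (measurePreserving_eval (fun _ : Fin m => uniform01) t).quasiMeasurePreserving.ae ae_uniform01

section Expectation

variable {n q : ℕ} {y : ℕ → ℝ} {z : ℝ} {c₁ : ℕ}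

/-- If some weight is positive, the index `j` is drawn with probability proportional to its
weight. -/
lemma lintegral_pick_le {ls : List ℕ} (hn : 1 ≤ n) (hq : n ≤ 2 ^ q)
    (hT : 0 < ∑ j ∈ Finset.range n, weight n y z c₁ ls j) (G : ℕ → ℝ≥0∞) :
    ∫⁻ u, G (pick n q (weight n y z c₁ ls) u).val ∂uniform01
      ≤ ∑ j ∈ Finset.range n, ENNReal.ofReal (weight n y z c₁ ls j
          / ∑ j ∈ Finset.range n, weight n y z c₁ ls j) * G j := by
  set a := weight n y z c₁ ls with ha
  set T := ∑ j ∈ Finset.range n, a j with hTdef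
  have hS : (SumTree.ofFun a q 0).sum = T := sum_ofFun_weight hq
  set I : ℕ → Set ℝ := fun j =>
    Set.Ico ((∑ i ∈ Finset.Ico 0 j, a i) / T) ((∑ i ∈ Finset.Ico 0 (j + 1), a i) / T) with hI
  calc ∫⁻ u, G (pick n q a u).val ∂uniform01
      ≤ ∫⁻ u in Set.Ico (0 : ℝ) 1, ∑ j ∈ Finset.range n, (I j).indicator (fun _ => G j) u := by
        refine setLIntegral_mono' measurableSet_Ico fun u hu => ?_
        have hpos : 0 < (SumTree.ofFun a q 0).sum := by rwa [hS]
        have hlt := pick_lt (q := q) (y := y) (z := z) (c₁ := c₁) (ls := ls) hn hu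
        have hf := SumTree.find_ofFun_val a q (u * (SumTree.ofFun a q 0).sum) 0
          (mul_nonneg hu.1 hpos.le) (by nlinarith [hu.2])
        rw [← pick_val_of_pos (n := n) hpos] at hf
        rw [← ha] at hlt
        set l := (pick n q a u).val
        have hmem : u ∈ I l := by
          rw [hS] at hf
          exact ⟨(div_le_iff₀ hT).2 hf.2.2.1, (lt_div_iff₀ hT).2 hf.2.2.2⟩
        calc G l = (I l).indicator (fun _ => G l) u := by rw [Set.indicator_of_mem hmem]
          _ ≤ _ := Finset.single_le_sum (f := fun j => (I j).indicator (fun _ => G j) u)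
              (fun _ _ => zero_le) (Finset.mem_range.2 hlt)
    _ ≤ ∫⁻ u, ∑ j ∈ Finset.range n, (I j).indicator (fun _ => G j) u :=
        setLIntegral_le_lintegral _ _
    _ = ∑ j ∈ Finset.range n, ENNReal.ofReal (a j / T) * G j := by
        rw [lintegral_finsetSum _ fun j _ => measurable_const.indicator measurableSet_Ico]
        refine Finset.sum_congr rfl fun j _ => ?_
        rw [lintegral_indicator_const measurableSet_Ico, Real.volume_Ico, mul_comm,
          Finset.sum_Ico_succ_top (Nat.zero_le j)]
        congr 2
        ring

/-- The potential bounds the exponential moment of the number of times the weight of `i`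
decreases. -/
lemma lintegral_exp_hits_le (hz : 1 ≤ z) (hy : ∀ i j, i ≤ j → j < n → y i ≤ y j) (hn : 1 ≤ n)
    (hq : n ≤ 2 ^ q) {i : ℕ} (hi : i < n) (m : ℕ) (ls : List ℕ) :
    ∫⁻ u, ENNReal.ofReal (Real.exp (rate z * hits n q y z c₁ i m u ls))
        ∂(Measure.pi fun _ : Fin m => uniform01)
      ≤ ENNReal.ofReal (potential n y z i (weight n y z c₁ ls i)) := by
  induction m generalizing ls with
  | zero =>
    simp only [hits, Nat.cast_zero, mul_zero, Real.exp_zero, lintegral_const, measure_univ, mul_one]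
    refine ENNReal.ofReal_le_ofReal ?_
    unfold potential
    have h1 : ∀ k : ℕ, (1 : ℝ) ≤ k + 1 := fun k => by linarith [k.cast_nonneg (α := ℝ)]
    exact one_le_mul_of_one_le_of_one_le (h1 _) (h1 _)
  | succ m ih =>
    set a := weight n y z c₁ ls with ha
    let F : ℝ × (Fin m → ℝ) → ℝ≥0∞ := fun p => ENNReal.ofReal
      (Real.exp (rate z * hits n q y z c₁ i (m + 1) (Fin.cons p.1 p.2) ls))
    have hF : Measurable F := by
      have h : Measurable fun p : ℝ × (Fin m → ℝ) =>
          hits n q y z c₁ i (m + 1) (Fin.cons p.1 p.2) ls :=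
        (discreteMeasurable_hits n q z c₁ i (m + 1) (u := fun p : ℝ × (Fin m → ℝ) =>
          (Fin.cons p.1 p.2 : Fin (m + 1) → ℝ)) (fun t => by
            refine Fin.cases ?_ (fun t => ?_) t
            · exact measurable_fst
            · exact (measurable_pi_apply t).comp measurable_snd) ls).measurable
      have h' : Measurable fun p : ℝ × (Fin m → ℝ) =>
          (hits n q y z c₁ i (m + 1) (Fin.cons p.1 p.2) ls : ℝ) := measurable_from_top.comp h
      exact (Real.measurable_exp.comp (h'.const_mul _)).ennreal_ofReal
    have hmp := measurePreserving_piFinSuccAbove (fun _ : Fin (m + 1) => uniform01) 0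
    have hcons : ∀ u : Fin (m + 1) → ℝ,
        ENNReal.ofReal (Real.exp (rate z * hits n q y z c₁ i (m + 1) u ls))
          = F (MeasurableEquiv.piFinSuccAbove (fun _ => ℝ) 0 u) := by
      intro u
      simp only [F]
      congr 5
      exact (Fin.cons_self_tail u).symm
    simp only [hcons]
    rw [hmp.lintegral_comp hF, lintegral_prod _ hF.aemeasurable]
    have hinner : ∀ x : ℝ, ∫⁻ t, F (x, t) ∂(Measure.pi fun _ : Fin m => uniform01)
        ≤ ENNReal.ofReal (nextPotential n y z c₁ ls i (pick n q a x).val) := by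
      intro x
      have e : ∀ t, F (x, t) = ENNReal.ofReal (if powDist y z i (pick n q a x).val < a i then
          Real.exp (rate z) else 1) * ENNReal.ofReal (Real.exp (rate z *
            hits n q y z c₁ i m t ((pick n q a x).val :: ls))) := by
        intro t
        rw [← ENNReal.ofReal_mul (by split_ifs <;> positivity)]
        simp only [F, hits, Fin.cons_zero, Fin.tail_cons]
        congr 1
        rw [← ha]
        split_ifs
        · rw [← Real.exp_add]; congr 1; push_cast; ring
        · simp
      simp only [e]
      rw [lintegral_const_mul' _ _ ENNReal.ofReal_ne_top, nextPotential,
        ENNReal.ofReal_mul (by split_ifs <;> positivity)]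
      gcongr
      exact ih _
    refine (lintegral_mono hinner).trans ?_
    by_cases hT : 0 < ∑ j ∈ Finset.range n, a j
    · refine (lintegral_pick_le hn hq hT
        fun j => ENNReal.ofReal (nextPotential n y z c₁ ls i j)).trans ?_
      have hnn : ∀ j, 0 ≤ a j := fun j => weight_nonneg j
      have hnp : ∀ j, 0 ≤ nextPotential n y z c₁ ls i j := fun j =>
        mul_nonneg (by split_ifs <;> positivity) (potential_nonneg _ _)
      simp only [← ha]
      rw [Finset.sum_congr rfl fun j _ => (ENNReal.ofReal_mul (div_nonneg (hnn j) hT.le)).symm,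
        ← ENNReal.ofReal_sum_of_nonneg fun j _ => mul_nonneg (div_nonneg (hnn j) hT.le) (hnp j)]
      refine ENNReal.ofReal_le_ofReal ?_
      have key := sum_weight_mul_nextPotential_le (c₁ := c₁) (ls := ls) hz hy hi
      simp only [← ha] at key
      rw [Finset.sum_congr rfl fun j _ => div_mul_eq_mul_div _ _ _, ← Finset.sum_div,
        div_le_iff₀ hT, mul_comm]
      exact key
    · -- all weights vanish, so no weight can decrease
      have hai : a i = 0 := by
        refine le_antisymm ?_ (weight_nonneg i)
        exact (Finset.single_le_sum (fun j _ => weight_nonneg j) (Finset.mem_range.2 hi)).trans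
          (not_lt.1 hT)
      have : ∀ j, nextPotential n y z c₁ ls i j = potential n y z i (a i) := fun j =>
        nextPotential_of_not_lt hi (by
          rw [← ha, hai]; exact not_lt.2 (powDist_nonneg _ _))
      simp [this]

lemma exp_average_le (hn : 1 ≤ n) (x : ℕ → ℝ) :
    Real.exp ((∑ i ∈ Finset.range n, x i) / n) ≤ (∑ i ∈ Finset.range n, Real.exp (x i)) / n := by
  have hn' : (n : ℝ) ≠ 0 := by positivity
  have := convexOn_exp.map_sum_le (t := Finset.range n) (w := fun _ => (n : ℝ)⁻¹) (p := x)
    (fun _ _ => by positivity) (by simp [hn']) (fun _ _ => Set.mem_univ _)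
  simp only [smul_eq_mul, ← Finset.mul_sum] at this
  rwa [div_eq_inv_mul, div_eq_inv_mul]

/-- The exponential moment of the average number of decreases per point. -/
lemma lintegral_exp_average_hits_le (hz : 1 ≤ z) (hy : ∀ i j, i ≤ j → j < n → y i ≤ y j)
    (hn : 1 ≤ n) (hq : n ≤ 2 ^ q) (m : ℕ) (ls : List ℕ) :
    ∫⁻ u, ENNReal.ofReal (Real.exp (rate z *
        ((∑ i ∈ Finset.range n, hits n q y z c₁ i m u ls : ℕ) : ℝ) / n))
        ∂(Measure.pi fun _ : Fin m => uniform01)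
      ≤ ENNReal.ofReal (((n : ℝ) + 1) ^ 2) := by
  have hn0 : (0 : ℝ) < n := by exact_mod_cast hn
  have hmeas : ∀ i, Measurable fun u : Fin m → ℝ =>
      ENNReal.ofReal (Real.exp (rate z * hits n q y z c₁ i m u ls)) := by
    intro i
    have h : Measurable fun u : Fin m → ℝ => hits n q y z c₁ i m u ls :=
      (discreteMeasurable_hits n q z c₁ i m (u := fun u => u) measurable_pi_apply ls).measurable
    have h' : Measurable fun u : Fin m → ℝ => (hits n q y z c₁ i m u ls : ℝ) :=
      measurable_from_top.comp h
    exact (Real.measurable_exp.comp (h'.const_mul _)).ennreal_ofReal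
  calc _ ≤ ∫⁻ u, ENNReal.ofReal (n : ℝ)⁻¹ * ∑ i ∈ Finset.range n,
          ENNReal.ofReal (Real.exp (rate z * hits n q y z c₁ i m u ls))
          ∂(Measure.pi fun _ : Fin m => uniform01) := by
        refine lintegral_mono fun u => ?_
        rw [← ENNReal.ofReal_sum_of_nonneg fun _ _ => (Real.exp_pos _).le,
          ← ENNReal.ofReal_mul (by positivity), ← div_eq_inv_mul]
        refine ENNReal.ofReal_le_ofReal (le_trans (le_of_eq ?_) (exp_average_le hn _))
        rw [← Finset.mul_sum, Nat.cast_sum]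
    _ = ENNReal.ofReal (n : ℝ)⁻¹ * ∑ i ∈ Finset.range n, ∫⁻ u,
          ENNReal.ofReal (Real.exp (rate z * hits n q y z c₁ i m u ls))
          ∂(Measure.pi fun _ : Fin m => uniform01) := by
        rw [lintegral_const_mul' _ _ ENNReal.ofReal_ne_top,
          lintegral_finsetSum _ fun i _ => hmeas i]
    _ ≤ ENNReal.ofReal (n : ℝ)⁻¹ * ∑ i ∈ Finset.range n, ENNReal.ofReal (((n : ℝ) + 1) ^ 2) := by
        gcongr with i hi
        exact (lintegral_exp_hits_le hz hy hn hq (Finset.mem_range.1 hi) m ls).trans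
          (ENNReal.ofReal_le_ofReal (potential_le (Finset.mem_range.1 hi) _))
    _ = ENNReal.ofReal (((n : ℝ) + 1) ^ 2) := by
        rw [Finset.sum_const, Finset.card_range, nsmul_eq_mul, ← mul_assoc, ← ENNReal.ofReal_natCast,
          ← ENNReal.ofReal_mul (by positivity), inv_mul_cancel₀ hn0.ne', ENNReal.ofReal_one, one_mul]

end Expectation

/-! ### Bounds on the running time -/

instance (d k : ℕ) : IsProbabilityMeasure (tapeLaw d k) := by unfold tapeLaw; infer_instance

lemma ae_isTape (d k : ℕ) : ∀ᵐ ω ∂(tapeLaw d k), IsTape ω := by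
  have h1 : ∀ᵐ ω ∂(tapeLaw d k), ω.2.1 ∈ Set.Ico (0 : ℝ) 1 :=
    Measure.quasiMeasurePreserving_snd.ae
      (Measure.quasiMeasurePreserving_fst.ae ae_uniform01)
  have h2 : ∀ᵐ ω ∂(tapeLaw d k), ∀ t, ω.2.2 t ∈ Set.Ico (0 : ℝ) 1 :=
    Measure.quasiMeasurePreserving_snd.ae
      (Measure.quasiMeasurePreserving_snd.ae (ae_pi_uniform01 (k - 1)))
  filter_upwards [h1, h2] with ω h1 h2
  exact ⟨h1, h2⟩

section Bounds

variable {d n k : ℕ} {z : ℝ}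

/-- A bound for the part of the running time that is not charged to decreases of weights. -/
noncomputable def baseTime (X : Fin n → EuclideanSpace ℝ (Fin d)) : ℝ :=
  19 * nnz X + 202 * (n * (treeDepth n + 1))

lemma measurable_runTimeModel (X : Fin n → EuclideanSpace ℝ (Fin d)) :
    Measurable fun ω : Tape d k => (runTimeModel X k z ω : ℝ) :=
  measurable_from_top.comp (discreteMeasurable_runTimeModel X).measurable

/-- The exponential moment of the running time, whatever the projection and the first center. -/
lemma lintegral_exp_runTimeModel_le (X : Fin n → EuclideanSpace ℝ (Fin d)) (hz : 1 ≤ z)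
    (hn : 1 ≤ n) (hk : 1 ≤ k) (hkn : k ≤ n) (hd : d ≤ nnz X) :
    ∫⁻ ω, ENNReal.ofReal (Real.exp (rate z * (runTimeModel X k z ω - baseTime X) / (28 * n)))
        ∂(tapeLaw d k) ≤ ENNReal.ofReal (((n : ℝ) + 1) ^ 2) := by
  have hn0 : (0 : ℝ) < n := by exact_mod_cast hn
  have hG : Measurable fun ω : Tape d k =>
      ENNReal.ofReal (Real.exp (rate z * (runTimeModel X k z ω - baseTime X) / (28 * n))) :=
    (Real.measurable_exp.comp (((measurable_runTimeModel X).sub_const _).const_mul _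
      |>.div_const _)).ennreal_ofReal
  have hinner : ∀ v u₁, ∫⁻ u, ENNReal.ofReal (Real.exp
      (rate z * (runTimeModel X k z (v, u₁, u) - baseTime X) / (28 * n)))
      ∂(Measure.pi fun _ : Fin (k - 1) => uniform01) ≤ ENNReal.ofReal (((n : ℝ) + 1) ^ 2) := by
    intro v u₁
    obtain ⟨y, c₁, hy, hle⟩ := exists_runTimeModel_le (z := z) X hn hk hkn hd v u₁
    refine le_trans (lintegral_mono_ae ?_) (lintegral_exp_average_hits_le (c₁ := c₁) hz hy hn
      (treeDepth_spec hn).1 (k - 1) [])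
    filter_upwards [ae_pi_uniform01 (k - 1)] with u hu
    refine ENNReal.ofReal_le_ofReal (Real.exp_le_exp.2 ?_)
    rw [div_le_div_iff₀ (by positivity) hn0]
    have h1 := hle u
    have h2 := seedModel_time_le_hits (y := y) (z := z) (c₁ := c₁) hn (treeDepth_spec hn).1 (k - 1)
      u hu []
    have h3 : (k - 1) * (treeDepth n + 1) ≤ n * (treeDepth n + 1) :=
      Nat.mul_le_mul_right _ (by omega)
    set H := ∑ i ∈ Finset.range n, hits n (treeDepth n) y z c₁ i (k - 1) u [] with hH
    have h4 : runTimeModel X k z (v, u₁, u)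
        ≤ 19 * nnz X + 202 * (n * (treeDepth n + 1)) + 28 * H := by omega
    have h5 : (runTimeModel X k z (v, u₁, u) : ℝ) - baseTime X ≤ 28 * H := by
      have : (runTimeModel X k z (v, u₁, u) : ℝ)
        ≤ 19 * nnz X + 202 * (n * (treeDepth n + 1)) + 28 * H := by exact_mod_cast h4
      rw [baseTime]; linarith
    have h6 := mul_le_mul_of_nonneg_left h5 (mul_nonneg (rate_pos z).le hn0.le)
    linarith
  rw [tapeLaw, lintegral_prod _ hG.aemeasurable]
  calc _ ≤ ∫⁻ _, ENNReal.ofReal (((n : ℝ) + 1) ^ 2)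
        ∂(Measure.pi fun _ : Fin d => gaussianReal 0 1) := by
        refine lintegral_mono fun v => ?_
        have hGv : Measurable fun p : ℝ × (Fin (k - 1) → ℝ) => ENNReal.ofReal
            (Real.exp (rate z * (runTimeModel X k z (v, p) - baseTime X) / (28 * n))) :=
          hG.comp measurable_prodMk_left
        rw [lintegral_prod _ hGv.aemeasurable]
        calc _ ≤ ∫⁻ _, ENNReal.ofReal (((n : ℝ) + 1) ^ 2) ∂uniform01 :=
              lintegral_mono fun u₁ => hinner v u₁
          _ = _ := by simp
    _ = _ := by simp

lemma runTimeModel_le (X : Fin n → EuclideanSpace ℝ (Fin d)) (hn : 1 ≤ n) (hk : 1 ≤ k)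
    (hkn : k ≤ n) (hd : d ≤ nnz X) {ω : Tape d k} (hω : IsTape ω) :
    (runTimeModel X k z ω : ℝ) ≤ baseTime X + 28 * (n * k) := by
  obtain ⟨y, c₁, -, hle⟩ := exists_runTimeModel_le (z := z) X hn hk hkn hd ω.1 ω.2.1
  have h1 := hle ω.2.2
  have h2 := seedModel_time_le (y := y) (z := z) (c₁ := c₁) hn (treeDepth_spec hn).1 (k - 1)
    ω.2.2 hω.2 []
  have h3 : (k - 1) * (28 * n + 24 * (treeDepth n + 1))
      ≤ 28 * (n * k) + 24 * (n * (treeDepth n + 1)) := by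
    calc (k - 1) * (28 * n + 24 * (treeDepth n + 1))
        = 28 * (n * (k - 1)) + 24 * ((k - 1) * (treeDepth n + 1)) := by ring
      _ ≤ _ := by gcongr <;> omega
  have h4 : runTimeModel X k z ω
      ≤ 19 * nnz X + 202 * (n * (treeDepth n + 1)) + 28 * (n * k) := by
    change runTimeModel X k z ω ≤ _ at h1
    omega
  rw [baseTime]
  exact_mod_cast h4

lemma mul_treeDepth_add_one_le (hn : 1 ≤ n) :
    (n : ℝ) * (treeDepth n + 1) ≤ 2 * n + 3 / 2 * (n * Real.log n) := by
  have hn0 : (0 : ℝ) < n := by exact_mod_cast hn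
  have h1 : ((2 : ℝ) ^ treeDepth n) ≤ 2 * n := by exact_mod_cast (treeDepth_spec hn).2
  have h2 := Real.log_le_log (by positivity) h1
  rw [Real.log_pow, Real.log_mul (by norm_num) hn0.ne'] at h2
  have h3 := Real.log_two_gt_d9
  have h4 : 0 ≤ Real.log n := Real.log_nonneg (by exact_mod_cast hn)
  have h5 : (treeDepth n : ℝ) ≤ 1 + 3 / 2 * Real.log n := by
    by_contra hc
    push Not at hc
    nlinarith
  nlinarith

/-- The expected running time, before the logarithms are simplified. -/
lemma lintegral_runTimeModel_le (X : Fin n → EuclideanSpace ℝ (Fin d)) (hz : 1 ≤ z)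
    (hn : 1 ≤ n) (hk : 1 ≤ k) (hkn : k ≤ n) (hd : d ≤ nnz X) :
    ∫⁻ ω, (runTimeModel X k z ω : ℝ≥0∞) ∂(tapeLaw d k)
      ≤ ENNReal.ofReal (baseTime X
        + 28 * n / rate z * (Real.log (((n : ℝ) + 1) ^ 2) + 1)) := by
  have hn0 : (0 : ℝ) < n := by exact_mod_cast hn
  have hr := rate_pos z
  set M : ℝ := ((n : ℝ) + 1) ^ 2 with hM
  have hM1 : 1 ≤ M := by rw [hM]; nlinarith
  have hlog : 0 ≤ Real.log M := Real.log_nonneg hM1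
  have hD : 0 ≤ baseTime X := by unfold baseTime; positivity
  set K : ℝ := 28 * n / rate z with hK
  have hK0 : 0 < K := by positivity
  calc ∫⁻ ω, (runTimeModel X k z ω : ℝ≥0∞) ∂(tapeLaw d k)
      ≤ ∫⁻ ω, (ENNReal.ofReal (baseTime X + K * Real.log M) + ENNReal.ofReal (K / M) *
          ENNReal.ofReal (Real.exp (rate z * (runTimeModel X k z ω - baseTime X) / (28 * n))))
          ∂(tapeLaw d k) := by
        refine lintegral_mono fun ω => ?_
        rw [← ENNReal.ofReal_mul (by positivity), ← ENNReal.ofReal_add (by positivity)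
          (by positivity), ← ENNReal.ofReal_natCast]
        refine ENNReal.ofReal_le_ofReal ?_
        set t : ℝ := rate z * (runTimeModel X k z ω - baseTime X) / (28 * n) with ht
        have e1 : (runTimeModel X k z ω : ℝ) = baseTime X + K * t := by
          rw [ht, hK]; field_simp; ring
        have e2 := Real.add_one_le_exp (t - Real.log M)
        rw [Real.exp_sub, Real.exp_log (by linarith)] at e2
        rw [e1]
        have e3 : K / M * Real.exp t = K * (Real.exp t / M) := by ring
        rw [e3]
        nlinarith
    _ = ENNReal.ofReal (baseTime X + K * Real.log M) + ENNReal.ofReal (K / M) *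
          ∫⁻ ω, ENNReal.ofReal (Real.exp (rate z * (runTimeModel X k z ω - baseTime X) / (28 * n)))
          ∂(tapeLaw d k) := by
        rw [lintegral_add_left measurable_const, lintegral_const_mul' _ _ ENNReal.ofReal_ne_top]
        simp
    _ ≤ ENNReal.ofReal (baseTime X + K * Real.log M) + ENNReal.ofReal (K / M) *
          ENNReal.ofReal M := by
        gcongr
        exact lintegral_exp_runTimeModel_le X hz hn hk hkn hd
    _ = _ := by
        rw [← ENNReal.ofReal_mul (by positivity), ← ENNReal.ofReal_add (by positivity)
          (by positivity)]
        congr 1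
        rw [div_mul_cancel₀ _ (by linarith : M ≠ 0)]
        ring

/-- A tail bound for the running time, before the logarithms are simplified. -/
lemma measure_lt_runTimeModel_le (X : Fin n → EuclideanSpace ℝ (Fin d)) (hz : 1 ≤ z)
    (hn : 1 ≤ n) (hk : 1 ≤ k) (hkn : k ≤ n) (hd : d ≤ nnz X) {δ : ℝ} (hδ : 0 < δ) :
    tapeLaw d k {ω | baseTime X + 28 * n / rate z * Real.log (((n : ℝ) + 1) ^ 2 / δ)
      < runTimeModel X k z ω} ≤ ENNReal.ofReal δ := by
  have hn0 : (0 : ℝ) < n := by exact_mod_cast hn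
  have hr := rate_pos z
  set M : ℝ := ((n : ℝ) + 1) ^ 2 with hM
  have hM0 : 0 < M := by positivity
  have hG : Measurable fun ω : Tape d k =>
      ENNReal.ofReal (Real.exp (rate z * (runTimeModel X k z ω - baseTime X) / (28 * n))) :=
    (Real.measurable_exp.comp (((measurable_runTimeModel X).sub_const _).const_mul _
      |>.div_const _)).ennreal_ofReal
  have hmarkov := (mul_meas_ge_le_lintegral (μ := tapeLaw d k) hG (ENNReal.ofReal (M / δ))).trans
    (lintegral_exp_runTimeModel_le X hz hn hk hkn hd)
  rw [← hM] at hmarkov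
  have hne : ENNReal.ofReal (M / δ) ≠ 0 := by
    rw [Ne, ENNReal.ofReal_eq_zero, not_le]; positivity
  calc _ ≤ tapeLaw d k {ω | ENNReal.ofReal (M / δ) ≤ ENNReal.ofReal
        (Real.exp (rate z * (runTimeModel X k z ω - baseTime X) / (28 * n)))} := by
        refine measure_mono fun ω hω => ENNReal.ofReal_le_ofReal ?_
        have hω : baseTime X + 28 * n / rate z * Real.log (M / δ) < runTimeModel X k z ω := hω
        rw [← Real.log_le_iff_le_exp (by positivity), le_div_iff₀ (by positivity)]
        rw [← lt_sub_iff_add_lt', div_mul_eq_mul_div, div_lt_iff₀ hr] at hω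
        linarith
    _ ≤ ENNReal.ofReal M / ENNReal.ofReal (M / δ) := by
        rw [ENNReal.le_div_iff_mul_le (Or.inl hne) (Or.inl ENNReal.ofReal_ne_top), mul_comm]
        exact hmarkov
    _ = ENNReal.ofReal δ := by
        rw [← ENNReal.ofReal_div_of_pos (by positivity)]
        congr 1
        field_simp

lemma baseTime_le (X : Fin n → EuclideanSpace ℝ (Fin d)) (hn : 1 ≤ n) :
    baseTime X ≤ 19 * nnz X + 404 * n + 303 * (n * Real.log n) := by
  have := mul_treeDepth_add_one_le hn
  rw [baseTime]; linarith

lemma div_rate (n z : ℝ) : 28 * n / rate z = 224 * (2 ^ (z / 2) * n) := by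
  rw [rate]; field_simp; ring

/-- The simplification of the bound for the expected running time; `E` stands for
`2 ^ (z / 2)`. -/
lemma expectation_bound {N E T : ℝ} (hN : 2 ≤ N) (hE : 1 ≤ E) (hT : 0 ≤ T) :
    19 * T + 404 * N + 303 * (N * Real.log N)
        + 224 * (E * N) * (Real.log ((N + 1) ^ 2) + 1)
      ≤ 3000 * (T + E * N * Real.log N) := by
  have hl : 0.69 ≤ Real.log N := by
    have h1 := Real.log_le_log (by norm_num) hN
    have h2 := Real.log_two_gt_d9
    linarith
  have h1 : Real.log ((N + 1) ^ 2) ≤ 4 * Real.log N := by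
    have h : (N + 1) ^ 2 ≤ N ^ 4 := by
      have h' : N + 1 ≤ N ^ 2 := by nlinarith
      calc (N + 1) ^ 2 ≤ (N ^ 2) ^ 2 := by gcongr
        _ = N ^ 4 := by ring
    have h' := Real.log_le_log (by positivity) h
    rwa [Real.log_pow (n := 4), Nat.cast_ofNat] at h'
  generalize Real.log ((N + 1) ^ 2) = M at *
  generalize Real.log N = L at *
  have h2 : N * L ≤ E * N * L := by
    rw [mul_assoc]; exact le_mul_of_one_le_left (by nlinarith) hE
  have h3 : N * 0.69 ≤ N * L := by gcongr
  have h4 : 224 * (E * N) * (M + 1) ≤ 224 * (E * N) * (6 * L) := by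
    gcongr; linarith
  linarith

/-- The simplification of the tail bound for the running time; `E` stands for `2 ^ (z / 2)`. -/
lemma tail_bound {N E T δ : ℝ} (hN : 1 ≤ N) (hE : 1 ≤ E) (hT : 0 ≤ T) (hδ : 0 < δ)
    (hδ2 : δ < 1 / 2) :
    19 * T + 404 * N + 303 * (N * Real.log N)
        + 224 * (E * N) * Real.log ((N + 1) ^ 2 / δ)
      ≤ 3000 * (T + E * N * Real.log (N / δ)) := by
  have hNδ : 2 ≤ N / δ := by rw [le_div_iff₀ hδ]; linarith
  have hl : 0.69 ≤ Real.log (N / δ) := by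
    have h1 := Real.log_le_log (by norm_num) hNδ
    have h2 := Real.log_two_gt_d9
    linarith
  have hll : Real.log N ≤ Real.log (N / δ) :=
    Real.log_le_log (by linarith) (by rw [le_div_iff₀ hδ]; nlinarith)
  have h1 : Real.log ((N + 1) ^ 2 / δ) ≤ 3 * Real.log (N / δ) := by
    have e : (N + 1) ^ 2 / δ ≤ (N / δ) ^ 3 := by
      rw [div_pow, div_le_div_iff₀ hδ (by positivity)]
      have e1 : (N + 1) ^ 2 ≤ 4 * N ^ 3 := by
        have h2 : (N + 1) ^ 2 ≤ (2 * N) ^ 2 := by gcongr; linarith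
        have h3 : N ^ 2 ≤ N ^ 3 := pow_le_pow_right₀ hN (by norm_num)
        linarith
      have e2 : 4 * δ ^ 2 ≤ 1 := by nlinarith
      calc (N + 1) ^ 2 * δ ^ 3 ≤ 4 * N ^ 3 * δ ^ 3 := by gcongr
        _ = N ^ 3 * δ * (4 * δ ^ 2) := by ring
        _ ≤ N ^ 3 * δ * 1 := by gcongr
        _ = N ^ 3 * δ := by ring
    have h' := Real.log_le_log (by positivity) e
    rwa [Real.log_pow (n := 3), Nat.cast_ofNat] at h'
  generalize Real.log ((N + 1) ^ 2 / δ) = M at *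
  generalize Real.log N = L' at *
  generalize Real.log (N / δ) = L at *
  have h2 : N * L ≤ E * N * L := by
    rw [mul_assoc]; exact le_mul_of_one_le_left (by nlinarith) hE
  have h3 : N * 0.69 ≤ N * L := by gcongr
  have h4 : 224 * (E * N) * M ≤ 224 * (E * N) * (3 * L) := by gcongr
  have h5 : N * L' ≤ N * L := by gcongr
  linarith

lemma runTime_le (X : Fin n → EuclideanSpace ℝ (Fin d)) (hz : 1 ≤ z) (hk : 1 ≤ k) (hkn : k ≤ n)
    (hd : d ≤ nnz X) {ω : Tape d k} (hω : IsTape ω) :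
    (runTime X k z ω : ℝ) ≤ 19 * nnz X + 303 * (n * Real.log n) + 432 * (n * k) := by
  have hn : 1 ≤ n := hk.trans hkn
  rw [runTime_eq_model X hz hk hn hω]
  have h1 := runTimeModel_le (z := z) X hn hk hkn hd hω
  have h2 : (n : ℝ) * 1 ≤ n * k := by gcongr; exact_mod_cast hk
  have h3 := baseTime_le X hn
  linarith

lemma ae_runTime_eq (X : Fin n → EuclideanSpace ℝ (Fin d)) (hz : 1 ≤ z) (hk : 1 ≤ k)
    (hkn : k ≤ n) : ∀ᵐ ω ∂(tapeLaw d k), runTime X k z ω = runTimeModel X k z ω :=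
  (ae_isTape d k).mono fun _ hω => runTime_eq_model X hz hk (hk.trans hkn) hω

lemma lintegral_runTime_le (X : Fin n → EuclideanSpace ℝ (Fin d)) (hz : 1 ≤ z) (hk : 1 ≤ k)
    (hkn : k ≤ n) (hd : d ≤ nnz X) (hpos : 1 ≤ nnz X) :
    ∫⁻ ω, (runTime X k z ω : ℝ≥0∞) ∂(tapeLaw d k)
      ≤ ENNReal.ofReal (3000 * (nnz X + 2 ^ (z / 2) * n * Real.log n)) := by
  rcases Nat.lt_or_ge n 2 with hn2 | hn2
  · -- there is only one point, hence only one center and no further round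
    obtain rfl : n = 1 := by omega
    obtain rfl : k = 1 := by omega
    have hpos' : (1 : ℝ) ≤ nnz X := by exact_mod_cast hpos
    calc ∫⁻ ω, (runTime X 1 z ω : ℝ≥0∞) ∂(tapeLaw d 1)
        ≤ ∫⁻ _, ENNReal.ofReal (3000 * nnz X) ∂(tapeLaw d 1) := by
          refine lintegral_mono_ae ?_
          filter_upwards [ae_isTape d 1] with ω hω
          rw [← ENNReal.ofReal_natCast]
          refine ENNReal.ofReal_le_ofReal ?_
          have h := runTime_le X hz hk hkn hd hω
          simp only [Nat.cast_one, Real.log_one, mul_zero, mul_one, add_zero] at h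
          linarith
      _ = _ := by simp
  · rw [lintegral_congr_ae ((ae_runTime_eq X hz hk hkn).mono fun ω h => by rw [h])]
    refine (lintegral_runTimeModel_le X hz (hk.trans hkn) hk hkn hd).trans
      (ENNReal.ofReal_le_ofReal ?_)
    rw [div_rate]
    have h := expectation_bound (N := n) (E := 2 ^ (z / 2)) (T := nnz X) (by exact_mod_cast hn2)
      (Real.one_le_rpow (by norm_num) (by linarith)) (Nat.cast_nonneg _)
    have h3 := baseTime_le X (hk.trans hkn)
    linarith

lemma le_measure_runTime_le (X : Fin n → EuclideanSpace ℝ (Fin d)) (hz : 1 ≤ z) (hk : 1 ≤ k)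
    (hkn : k ≤ n) (hd : d ≤ nnz X) {δ : ℝ} (hδ : 0 < δ) (hδ2 : δ < 1 / 2) :
    ENNReal.ofReal (1 - δ) ≤ tapeLaw d k {ω | (runTime X k z ω : ℝ)
      ≤ 3000 * (nnz X + 2 ^ (z / 2) * n * Real.log (n / δ))} := by
  have hn : 1 ≤ n := hk.trans hkn
  have h0 := measure_lt_runTimeModel_le (z := z) X hz hn hk hkn hd hδ
  rw [div_rate] at h0
  have h1 := tail_bound (N := n) (E := 2 ^ (z / 2)) (T := nnz X) (by exact_mod_cast hn)
    (Real.one_le_rpow (by norm_num) (by linarith)) (Nat.cast_nonneg _) hδ hδ2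
  have h2 := baseTime_le X hn
  set s := {ω : Tape d k | baseTime X + 224 * (2 ^ (z / 2) * n)
    * Real.log (((n : ℝ) + 1) ^ 2 / δ) < runTimeModel X k z ω} with hs
  have hmeas : MeasurableSet s := measurableSet_lt measurable_const (measurable_runTimeModel X)
  rw [ENNReal.ofReal_sub _ hδ.le, ENNReal.ofReal_one]
  calc 1 - ENNReal.ofReal δ ≤ 1 - tapeLaw d k s := tsub_le_tsub_left h0 1
    _ = tapeLaw d k sᶜ := (prob_compl_eq_one_sub hmeas).symm
    _ ≤ _ := by
      refine measure_mono_ae ((ae_runTime_eq X hz hk hkn).mono fun ω hω hmem => ?_)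
      have hmem : ω ∉ s := hmem
      rw [hs, Set.mem_ofPred_eq, not_lt] at hmem
      change (runTime X k z ω : ℝ) ≤ _
      rw [hω]
      linarith

end Bounds

end Prone

theorem theorem1 :
    ∃ C : ℝ, 0 < C ∧
      ∀ (d n k : ℕ) (X : Fin n → EuclideanSpace ℝ (Fin d)) (z : ℝ),
        1 ≤ d → d ≤ Prone.nnz X → 1 ≤ k → k ≤ n → 1 ≤ z →
        AEMeasurable (fun ω : Prone.Tape d k => Prone.runTime X k z ω) (Prone.tapeLaw d k) ∧
        ∫⁻ ω, (Prone.runTime X k z ω : ℝ≥0∞) ∂(Prone.tapeLaw d k)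
          ≤ ENNReal.ofReal
              (C * ((Prone.nnz X : ℝ) + (2 : ℝ) ^ (z / 2) * (n : ℝ) * Real.log (n : ℝ))) ∧
        (∀ δ : ℝ, 0 < δ → δ < 1 / 2 →
          ENNReal.ofReal (1 - δ) ≤ Prone.tapeLaw d k
            {ω | (Prone.runTime X k z ω : ℝ)
              ≤ C * ((Prone.nnz X : ℝ)
                  + (2 : ℝ) ^ (z / 2) * (n : ℝ) * Real.log ((n : ℝ) / δ))}) ∧
        (∀ ω : Prone.Tape d k, Prone.IsTape ω →
          (Prone.runTime X k z ω : ℝ)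
            ≤ C * ((Prone.nnz X : ℝ) + (n : ℝ) * Real.log (n : ℝ) + (n : ℝ) * (k : ℝ))) := by
  refine ⟨3000, by norm_num, fun d n k X z hd1 hd hk hkn hz => ⟨?_, ?_, ?_, ?_⟩⟩
  · exact ⟨fun ω => Prone.runTimeModel X k z ω,
      (Prone.discreteMeasurable_runTimeModel X).measurable, Prone.ae_runTime_eq X hz hk hkn⟩
  · exact Prone.lintegral_runTime_le X hz hk hkn hd (hd1.trans hd)
  · exact fun δ hδ hδ2 => Prone.le_measure_runTime_le X hz hk hkn hd hδ hδ2
  · intro ω hω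
    have h1 := Prone.runTime_le X hz hk hkn hd hω
    have h2 : 0 ≤ (n : ℝ) * Real.log n :=
      mul_nonneg (Nat.cast_nonneg _) (Real.log_natCast_nonneg n)
    have h3 : 0 ≤ (n : ℝ) * k := by positivity
    have h4 : (0 : ℝ) ≤ Prone.nnz X := Nat.cast_nonneg _
    linarith
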